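/- Let $d\in\mathbb N$, $\varepsilon>0$, $\sigma>0$, $C(x,y)=\|x-y\|^2$ on $\mathbb R^d$. For probability measures $\mu$ write $\mathrm{KL}(\mu|\nu)=\int\log\frac{d\mu}{d\nu}\,d\mu$ ($+\infty$ if $\mu\not\ll\nu$ or if $\log\frac{d\mu}{d\nu}\notin L^1(\mu)$), let $\mathcal L$ be Lebesgue measure, and for reference measures $m_1,m_2$ put $$\mathrm{OT}_\varepsilon^{m_1,m_2}(\alpha,\beta)=\inf_{\pi\in\Pi(\alpha,\beta)}\int C\,d\pi+\varepsilon\,\mathrm{KL}(\pi|m_1\otimes m_2),$$ $\mathrm{OT}_\varepsilon^{\mathcal L}=\mathrm{OT}_\varepsilon^{\mathcal L,\mathcal L}$ and $\mathrm{OT}_\varepsilon^{\otimes}(\alpha,\beta)=\mathrm{OT}_\varepsilon^{\alpha,\beta}(\alpha,\beta)$. A probability measure $\mu$ on $\mathbb R^d$ is in $\mathcal G_\sigma$ if $\int e^{\|x\|^2/(2d\sigma^2)}d\mu\le 2$, and $\mathcal G=\bigcup_{\tau>0}\mathcal G_\tau$. Let $\alpha,\beta\in\mathcal G_\sigma$ have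 everywhere positive Lebesgue densities $a,b$ and finite entropies $\mathrm{KL}(\alpha|\mathcal L),\mathrm{KL}(\beta|\mathcal L)<\infty$. Call $(\varphi,\psi)\in L^1(\alpha)\times L^1(\beta)$ (real-valued everywhere) product potentials if for all $x,y\in\mathbb R^d$ $$e^{\varphi(x)/\varepsilon}\int e^{(\psi(y)-C(x,y))/\varepsilon}d\beta(y)=1,\qquad e^{\psi(y)/\varepsilon}\int e^{(\varphi(x)-C(x,y))/\varepsilon}d\alpha(x)=1,$$ and call $(f,g)\in L^1(\alpha)\times L^1(\beta)$ Lebesgue potentials if for all $x,y\in\mathbb R^d$ $$e^{f(x)/\varepsilon}\int e^{(g(y)-C(x,y))/\varepsilon}dy=a(x),\qquad e^{g(y)/\varepsilon}\int e^{(f(x)-C(x,y))/\varepsilon}dx=b(y).$$ Then: 1. Product potentials exist. All product potentials $(\varphi,\psi)$ are continuous and maximize $\int u\,d\alpha+\int v\,d\beta-\varepsilon\iint e^{(u\oplus v-C)/\varepsilon}d\alpha\,d\beta+\varepsilon$ over $u\in L^1(\alpha)$, $v\in L^1(\beta)$, and $\mathrm{OT}_\varepsilon^\otimes(\alpha,\beta)=\int\varphi\,d\alpha+\int\psi\,d\beta$.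 2. $(\varphi,\psi)$ are product potentials if and only if $(\varphi+\varepsilon\log a,\ \psi+\varepsilon\log b)$ are Lebesgue potentials. 3. All Lebesgue potentials $(f,g)$ maximize the dual functional $J(u,v)=\int u\,d\alpha+\int v\,d\beta-\varepsilon\iint e^{(u(x)+v(y)-C(x,y))/\varepsilon}dx\,dy+\varepsilon$ over $L^1(\alpha)\times L^1(\beta)$, and $\mathrm{OT}_\varepsilon^{\mathcal L}(\alpha,\beta)=J(f,g)=\int f\,d\alpha+\int g\,d\beta$. If $a$ (resp. $b$) is continuous, so is $f$ (resp. $g$). 4. $\mathrm{OT}_\varepsilon^{\mathcal L}$ is differentiable at $(\alpha,\beta)$ along feasible directions with gradient $(f,g)$, for all Lebesgue potentials $(f,g)$: it is finite at $(\alpha,\beta)$, and for all feasible directions $\delta\alpha=\alpha_1-\alpha_2$ at $\alpha$ and $\delta\beta=\beta_1-\beta_2$ at $\beta$, $f\in L^1(\alpha_1)\cap L^1(\alpha_2)$, $g\in L^1(\beta_1)\cap L^1(\beta_2)$, $\mathrm{OT}_\varepsilon^{\mathcal L}(\alpha+t\delta\alpha,\beta+t\delta\beta)$ is finite for small $t>0$,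 and $$\mathrm{OT}_\varepsilon^{\mathcal L}(\alpha+t\,\delta\alpha,\beta+t\,\delta\beta)=\mathrm{OT}_\varepsilon^{\mathcal L}(\alpha,\beta)+t\Big(\int f\,d\delta\alpha+\int g\,d\delta\beta\Big)+o(t)\qquad(t\downarrow0).$$ Here $\delta\alpha=\alpha_1-\alpha_2$ is a feasible direction at $\alpha$ if $\alpha_1,\alpha_2\in\mathcal G$ have Lebesgue densities, $\alpha+t\,\delta\alpha$ is, for all small $t>0$, a nonnegative measure with $\mathrm{KL}(\alpha+t\,\delta\alpha|\mathcal L)<\infty$, and $\log a\in L^1(\alpha_1)\cap L^1(\alpha_2)$; likewise at $\beta$. -/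

import Mathlib

open MeasureTheory Filter Topology Asymptotics
open scoped ENNReal

/-- The space `ℝ^d` with its Euclidean norm. -/
abbrev Eucl (d : ℕ) : Type := EuclideanSpace ℝ (Fin d)

/-- `μ ∈ 𝒢_σ(ℝ^d)`: `𝔼_μ exp (‖X‖² / (2 d σ²)) ≤ 2`. -/
def SubGaussian {d : ℕ} (σ : ℝ) (μ : Measure (Eucl d)) : Prop :=
  ∫⁻ x, ENNReal.ofReal (Real.exp (‖x‖ ^ 2 / (2 * d * σ ^ 2))) ∂μ ≤ 2

open Classical in
/-- Relative entropy `KL(μ | ν) = ∫ log (dμ/dν) dμ`, equal to `⊤` if `μ` is not absolutely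
continuous with respect to `ν` or if the logarithm is not integrable. The reference `ν` may be
infinite (Lebesgue measure). For a probability measure `μ` the negative part of `log (dμ/dν)` is
`μ`-integrable as soon as `ν` is a probability measure, or `ν` is Lebesgue measure and `μ` has a
finite second moment, so that the value `⊤` then means a divergent positive part. -/
noncomputable def relEntropy {X : Type*} [MeasurableSpace X] (μ ν : Measure X) : EReal :=
  if μ ≪ ν ∧ Integrable (llr μ ν) μ then ((∫ x, llr μ ν x ∂μ : ℝ) : EReal) else ⊤

/-- `π` is a transport plan between `α` and `β`. -/
def IsTransportPlan {d : ℕ} (α β : Measure (Eucl d)) (π : Measure (Eucl d × Eucl d)) : Prop :=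
  π.fst = α ∧ π.snd = β

/-- Entropy-regularized optimal transport with squared Euclidean cost and reference `m₁ ⊗ m₂`:
`inf_π ∫ ‖x - y‖² dπ + ε KL(π | m₁ ⊗ m₂)` over the transport plans `π` between `α` and `β`. -/
noncomputable def entropicOT {d : ℕ} (ε : ℝ) (m₁ m₂ α β : Measure (Eucl d)) : EReal :=
  ⨅ (π : Measure (Eucl d × Eucl d)) (_ : IsTransportPlan α β π),
    ((∫⁻ z, ENNReal.ofReal (‖z.1 - z.2‖ ^ 2) ∂π : ℝ≥0∞) : EReal)
      + (ε : EReal) * relEntropy π (m₁.prod m₂)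

/-- `OT_ε^⊗`: the reference is the product of the marginals. -/
noncomputable def otProduct {d : ℕ} (ε : ℝ) (α β : Measure (Eucl d)) : EReal :=
  entropicOT ε α β α β

/-- `OT_ε^𝓛`: the reference is Lebesgue measure. -/
noncomputable def otLebesgue {d : ℕ} (ε : ℝ) (α β : Measure (Eucl d)) : EReal :=
  entropicOT ε volume volume α β

/-- The objective of the dual problem,
`⟨f, α⟩ + ⟨g, β⟩ - ε ∬ exp ((f(x) + g(y) - ‖x - y‖²) / ε) dm₁(x) dm₂(y) + ε`;
it is `⊥` where the exponential integral is infinite. -/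
noncomputable def dualObjective {d : ℕ} (ε : ℝ) (m₁ m₂ α β : Measure (Eucl d))
    (f g : Eucl d → ℝ) : EReal :=
  ((∫ x, f x ∂α + ∫ y, g y ∂β + ε : ℝ) : EReal)
    - (ε : EReal) * ((∫⁻ z, ENNReal.ofReal
        (Real.exp ((f z.1 + g z.2 - ‖z.1 - z.2‖ ^ 2) / ε)) ∂(m₁.prod m₂) : ℝ≥0∞) : EReal)

/-- `(f, g)` maximizes the dual objective over `L¹(α) × L¹(β)`. -/
def IsDualOptimal {d : ℕ} (ε : ℝ) (m₁ m₂ α β : Measure (Eucl d)) (f g : Eucl d → ℝ) : Prop :=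
  Integrable f α ∧ Integrable g β ∧
    ∀ u v : Eucl d → ℝ, Integrable u α → Integrable v β →
      dualObjective ε m₁ m₂ α β u v ≤ dualObjective ε m₁ m₂ α β f g

/-- Sinkhorn fixed-point equations for the product reference, everywhere on `ℝ^d`. (An integral
that diverges counts as `0`, so the equations contain the convergence of their integrals.) -/
structure IsProductSinkhorn {d : ℕ} (ε : ℝ) (α β : Measure (Eucl d)) (f g : Eucl d → ℝ) :
    Prop where
  integrable_fst : Integrable f α
  integrable_snd : Integrable g β
  eq_fst : ∀ x, Real.exp (f x / ε) * ∫ y, Real.exp ((g y - ‖x - y‖ ^ 2) / ε) ∂β = 1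
  eq_snd : ∀ y, Real.exp (g y / ε) * ∫ x, Real.exp ((f x - ‖x - y‖ ^ 2) / ε) ∂α = 1

/-- Sinkhorn fixed-point equations for the Lebesgue reference, everywhere on `ℝ^d`, for measures
`α`, `β` with positive densities `a`, `b`. -/
structure IsLebesgueSinkhorn {d : ℕ} (ε : ℝ) (α β : Measure (Eucl d)) (a b : Eucl d → ℝ)
    (f g : Eucl d → ℝ) : Prop where
  integrable_fst : Integrable f α
  integrable_snd : Integrable g β
  eq_fst : ∀ x, Real.exp (f x / ε) * ∫ y, Real.exp ((g y - ‖x - y‖ ^ 2) / ε) = a x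
  eq_snd : ∀ y, Real.exp (g y / ε) * ∫ x, Real.exp ((f x - ‖x - y‖ ^ 2) / ε) = b y

/-- The displaced measure `α + t (α₁ - α₂)`, for `t ≥ 0` with `t α₂ ≤ α + t α₁`. -/
noncomputable def displaced {d : ℕ} (α α₁ α₂ : Measure (Eucl d)) (t : ℝ) : Measure (Eucl d) :=
  (α + ENNReal.ofReal t • α₁) - ENNReal.ofReal t • α₂

/-- `α₁ - α₂` is a feasible direction at `α`: `α₁` and `α₂` are sub-Gaussian probability measures
with Lebesgue densities, `α + t (α₁ - α₂)` is for small `t > 0` a nonnegative measure of finite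
entropy, and the pairing of `log (dα/dx)` with `α₁ - α₂` converges. -/
structure IsFeasibleDirection {d : ℕ} (α α₁ α₂ : Measure (Eucl d)) : Prop where
  prob₁ : IsProbabilityMeasure α₁
  prob₂ : IsProbabilityMeasure α₂
  subGaussian₁ : ∃ τ : ℝ, 0 < τ ∧ SubGaussian τ α₁
  subGaussian₂ : ∃ τ : ℝ, 0 < τ ∧ SubGaussian τ α₂
  ac₁ : α₁ ≪ volume
  ac₂ : α₂ ≪ volume
  nonneg : ∀ᶠ t in 𝓝[>] (0 : ℝ), ENNReal.ofReal t • α₂ ≤ α + ENNReal.ofReal t • α₁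
  entropy : ∀ᶠ t in 𝓝[>] (0 : ℝ), relEntropy (displaced α α₁ α₂ t) volume ≠ ⊤
  log₁ : Integrable (llr α volume) α₁
  log₂ : Integrable (llr α volume) α₂

/-- `F` is differentiable at `(α, β)` along feasible directions with gradient `(f, g)`:
`F` is finite at `(α, β)` and, for all feasible directions `δα = α₁ - α₂`, `δβ = β₁ - β₂`,
`F(α + t δα, β + t δβ)` is finite for small `t > 0`, the pairings `⟨δα, f⟩`, `⟨δβ, g⟩` converge, and
`F(α + t δα, β + t δβ) = F(α, β) + t (⟨δα, f⟩ + ⟨δβ, g⟩) + o(t)` as `t ↓ 0`. -/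
def HasFeasibleGradient {d : ℕ} (F : Measure (Eucl d) → Measure (Eucl d) → EReal)
    (α β : Measure (Eucl d)) (f g : Eucl d → ℝ) : Prop :=
  F α β ≠ ⊤ ∧ F α β ≠ ⊥ ∧
    ∀ α₁ α₂ β₁ β₂ : Measure (Eucl d),
      IsFeasibleDirection α α₁ α₂ → IsFeasibleDirection β β₁ β₂ →
        Integrable f α₁ ∧ Integrable f α₂ ∧ Integrable g β₁ ∧ Integrable g β₂ ∧
        (∀ᶠ t in 𝓝[>] (0 : ℝ), F (displaced α α₁ α₂ t) (displaced β β₁ β₂ t) ≠ ⊤ ∧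
          F (displaced α α₁ α₂ t) (displaced β β₁ β₂ t) ≠ ⊥) ∧
        (fun t : ℝ => (F (displaced α α₁ α₂ t) (displaced β β₁ β₂ t)).toReal - (F α β).toReal
            - t * ((∫ x, f x ∂α₁ - ∫ x, f x ∂α₂) + (∫ y, g y ∂β₁ - ∫ y, g y ∂β₂)))
          =o[𝓝[>] (0 : ℝ)] (fun t : ℝ => t)

/-!
For a reference `m₁ ⊗ m₂` and functions `f`, `g`, the Gibbs plan is the measure with density
`exp ((f(x) + g(y) - ‖x - y‖²) / ε)`. Weak duality (`dualObjective_le_primalObjective`) holds for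
every plan and every pair of integrable functions, by `1 + s ≤ exp s`. If the Gibbs plan of `(f, g)`
couples `α` and `β`, it is an equality for this plan and `(f, g)`, which gives the optimality and the
value for both references (`isDualOptimal_of_gibbsPlan`). The Sinkhorn equations say that the Gibbs
plan is a coupling, and adding `ε log a`, `ε log b` to product potentials changes the reference.

Product potentials are fixed points of the soft transform `T u(y) = -ε log ∫ exp ((u - C) / ε)`. In
the exponent `u(x) - ‖x - y‖²` the terms `‖x‖²` cancel for functions with
`u(x) ≤ ‖x‖² + K (1 + ‖x‖)`, so `T` is defined on them whatever the sub-Gaussian constant. The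
transform turns upper bounds into lower bounds, and lower bounds on the mean into upper bounds; hence
the dual problem has maximizing sequences with uniform growth bounds
(`exists_tame_near_maximizer`). By `(exp A + exp B) / 2 - exp ((A + B) / 2) =
(exp (A / 2) - exp (B / 2))² / 2`, square roots of the Gibbs densities are Cauchy in `L²` along such a
sequence (`integral_sqrtGibbs_sub_sq_le`). Normalized potentials therefore converge, and the same
identity shows that the limit is a fixed point (`exists_softTransform_fixedPoint`). Potentials are
continuous because the integral in `T` is, up to a Gaussian factor, a finite Laplace transform, which
is convex.

For the gradient, weak duality with the fixed `(f, g)` is an affine lower bound for the value along a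
feasible direction. For the upper bound, write `α_t = (1 - t/s) α + (t/s) α_s`, likewise `β_t`, and
take `(1 - t/s) π + (t/s) α_s ⊗ β_s` as competitor, where `π` is the Gibbs plan. The derivative of the
primal objective at `π` is the integral of `f(x) + g(y)` against the change of the plan, so it depends
on the change of the marginals only and agrees with the lower bound
(`exists_primal_bound_on_segment`, `hasFeasibleGradient_of_gibbsPlan`). No convergence of the
potentials as `t ↓ 0` is needed.
-/

/-! ### Duality for a general reference measure -/

/-- The relative entropy of a measure with real density `q` is `∫ q log q`. -/
theorem relEntropy_withDensity {X : Type*} [MeasurableSpace X] (ρ : Measure X) [SigmaFinite ρ]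
    {q : X → ℝ} (hq : Measurable q) (hq0 : ∀ x, 0 ≤ q x)
    (hint : Integrable (fun x => q x * Real.log (q x)) ρ) :
    relEntropy (ρ.withDensity fun x => ENNReal.ofReal (q x)) ρ
      = ((∫ x, q x * Real.log (q x) ∂ρ : ℝ) : EReal) := by
  have hm : Measurable fun x => ENNReal.ofReal (q x) := hq.ennreal_ofReal
  have hlt : ∀ᵐ x ∂ρ, ENNReal.ofReal (q x) < ∞ :=
    Eventually.of_forall fun _ => ENNReal.ofReal_lt_top
  have hae : (fun x => (ENNReal.ofReal (q x)).toReal •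
      llr (ρ.withDensity fun x => ENNReal.ofReal (q x)) ρ x)
      =ᵐ[ρ] fun x => q x * Real.log (q x) := by
    filter_upwards [Measure.rnDeriv_withDensity ρ hm] with x hx
    simp only [llr, hx, ENNReal.toReal_ofReal (hq0 x), smul_eq_mul]
  have hI : Integrable (llr (ρ.withDensity fun x => ENNReal.ofReal (q x)) ρ)
      (ρ.withDensity fun x => ENNReal.ofReal (q x)) := by
    rw [integrable_withDensity_iff_integrable_smul' hm hlt]
    exact hint.congr hae.symm
  rw [relEntropy, if_pos ⟨withDensity_absolutelyContinuous _ _, hI⟩,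
    integral_withDensity_eq_integral_toReal_smul hm hlt, integral_congr_ae hae]

/-- A density weighted by the exponential of the negative log-likelihood ratio has at most the
mass of the unweighted reference. No measurability of `W` is needed. -/
theorem lintegral_exp_sub_llr_le {X : Type*} [MeasurableSpace X] {π ρ : Measure X}
    [SigmaFinite π] [SigmaFinite ρ] (hac : π ≪ ρ) (W : X → ℝ) :
    ∫⁻ z, ENNReal.ofReal (Real.exp (W z - llr π ρ z)) ∂π
      ≤ ∫⁻ z, ENNReal.ofReal (Real.exp (W z)) ∂ρ := by
  obtain ⟨g, hg, hgle, hgeq⟩ := exists_measurable_le_lintegral_eq π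
    (fun z => ENNReal.ofReal (Real.exp (W z - llr π ρ z)))
  rw [hgeq, ← lintegral_rnDeriv_mul hac hg.aemeasurable]
  refine lintegral_mono_ae ?_
  filter_upwards [Measure.rnDeriv_lt_top π ρ] with z hz
  by_cases h0 : π.rnDeriv ρ z = 0
  · simp [h0]
  · have hpos : 0 < (π.rnDeriv ρ z).toReal := ENNReal.toReal_pos h0 hz.ne
    calc π.rnDeriv ρ z * g z
        ≤ π.rnDeriv ρ z * ENNReal.ofReal (Real.exp (W z - llr π ρ z)) := by gcongr; exact hgle z
      _ = ENNReal.ofReal ((π.rnDeriv ρ z).toReal)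
            * ENNReal.ofReal (Real.exp (W z - llr π ρ z)) := by rw [ENNReal.ofReal_toReal hz.ne]
      _ = ENNReal.ofReal (Real.exp (W z)) := by
          rw [← ENNReal.ofReal_mul hpos.le, llr, Real.exp_sub, Real.exp_log hpos]
          congr 1; field_simp
      _ ≤ _ := le_rfl

/-- A form of the Gibbs variational inequality. -/
theorem integral_sub_integral_llr_le {X : Type*} [MeasurableSpace X] {π ρ : Measure X}
    [IsProbabilityMeasure π] [SigmaFinite ρ] (hac : π ≪ ρ) (hllr : Integrable (llr π ρ) π)
    {W : X → ℝ} (hW : Integrable W π)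
    (hfin : ∫⁻ z, ENNReal.ofReal (Real.exp (W z)) ∂ρ ≠ ∞) :
    ∫ z, W z ∂π - ∫ z, llr π ρ z ∂π + 1
      ≤ (∫⁻ z, ENNReal.ofReal (Real.exp (W z)) ∂ρ).toReal := by
  have hle := lintegral_exp_sub_llr_le hac W
  have hmeas : AEStronglyMeasurable (fun z => Real.exp (W z - llr π ρ z)) π :=
    Real.continuous_exp.comp_aestronglyMeasurable (hW.sub hllr).aestronglyMeasurable
  have hexp : Integrable (fun z => Real.exp (W z - llr π ρ z)) π := by
    refine ⟨hmeas, ?_⟩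
    rw [hasFiniteIntegral_iff_ofReal (Eventually.of_forall fun _ => (Real.exp_pos _).le)]
    exact hle.trans_lt hfin.lt_top
  have hsub : Integrable (fun z => W z - llr π ρ z) π := hW.sub hllr
  have h1 : ∫ z, W z ∂π - ∫ z, llr π ρ z ∂π + 1 = ∫ z, (W z - llr π ρ z + 1) ∂π := by
    rw [integral_add hsub (integrable_const _), integral_sub hW hllr]
    simp
  rw [h1]
  calc ∫ z, (W z - llr π ρ z + 1) ∂π ≤ ∫ z, Real.exp (W z - llr π ρ z) ∂π :=
        integral_mono ((hW.sub hllr).add (integrable_const _)) hexp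
          fun z => Real.add_one_le_exp _
    _ = (∫⁻ z, ENNReal.ofReal (Real.exp (W z - llr π ρ z)) ∂π).toReal :=
        integral_eq_lintegral_of_nonneg_ae (Eventually.of_forall fun _ => (Real.exp_pos _).le) hmeas
    _ ≤ _ := ENNReal.toReal_mono hfin hle

/-- The primal objective of a plan `π`, with reference `m₁ ⊗ m₂`. -/
noncomputable def primalObjective {d : ℕ} (ε : ℝ) (m₁ m₂ : Measure (Eucl d))
    (π : Measure (Eucl d × Eucl d)) : EReal :=
  ((∫⁻ z, ENNReal.ofReal (‖z.1 - z.2‖ ^ 2) ∂π : ℝ≥0∞) : EReal)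
    + (ε : EReal) * relEntropy π (m₁.prod m₂)

theorem entropicOT_le_primalObjective {d : ℕ} {ε : ℝ} {m₁ m₂ α β : Measure (Eucl d)}
    {π : Measure (Eucl d × Eucl d)} (hπ : IsTransportPlan α β π) :
    entropicOT ε m₁ m₂ α β ≤ primalObjective ε m₁ m₂ π :=
  iInf₂_le (f := fun π (_ : IsTransportPlan α β π) => primalObjective ε m₁ m₂ π) π hπ

section Plan

variable {d : ℕ} {ε : ℝ} {m₁ m₂ α β : Measure (Eucl d)} {π : Measure (Eucl d × Eucl d)}

theorem IsTransportPlan.isProbabilityMeasure [IsProbabilityMeasure α]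
    (hπ : IsTransportPlan α β π) : IsProbabilityMeasure π := by
  constructor
  rw [← Measure.fst_univ, hπ.1, measure_univ]

theorem IsTransportPlan.integrable_fst (hπ : IsTransportPlan α β π) {u : Eucl d → ℝ}
    (hu : Integrable u α) : Integrable (fun z => u z.1) π := by
  have : Integrable u (π.map Prod.fst) := by rw [← hπ.1] at hu; exact hu
  exact this.comp_measurable measurable_fst

theorem IsTransportPlan.integrable_snd (hπ : IsTransportPlan α β π) {v : Eucl d → ℝ}
    (hv : Integrable v β) : Integrable (fun z => v z.2) π := by
  have : Integrable v (π.map Prod.snd) := by rw [← hπ.2] at hv; exact hv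
  exact this.comp_measurable measurable_snd

theorem IsTransportPlan.integral_fst (hπ : IsTransportPlan α β π) {u : Eucl d → ℝ}
    (hu : Integrable u α) : ∫ z, u z.1 ∂π = ∫ x, u x ∂α := by
  have h1 : AEStronglyMeasurable u (π.map Prod.fst) := by
    rw [← hπ.1] at hu; exact hu.aestronglyMeasurable
  rw [← hπ.1]
  exact (integral_map measurable_fst.aemeasurable h1).symm

theorem IsTransportPlan.integral_snd (hπ : IsTransportPlan α β π) {v : Eucl d → ℝ}
    (hv : Integrable v β) : ∫ z, v z.2 ∂π = ∫ x, v x ∂β := by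
  have h1 : AEStronglyMeasurable v (π.map Prod.snd) := by
    rw [← hπ.2] at hv; exact hv.aestronglyMeasurable
  rw [← hπ.2]
  exact (integral_map measurable_snd.aemeasurable h1).symm

theorem norm_sub_sq_le_two_mul (x y : Eucl d) : ‖x - y‖ ^ 2 ≤ 2 * ‖x‖ ^ 2 + 2 * ‖y‖ ^ 2 := by
  have := parallelogram_law_with_norm ℝ x y
  nlinarith [mul_self_nonneg ‖x + y‖]

theorem IsTransportPlan.integrable_cost (hπ : IsTransportPlan α β π)
    (hα2 : Integrable (fun x => ‖x‖ ^ 2) α) (hβ2 : Integrable (fun x => ‖x‖ ^ 2) β) :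
    Integrable (fun z => ‖z.1 - z.2‖ ^ 2) π := by
  refine (((hπ.integrable_fst hα2).const_mul 2).add ((hπ.integrable_snd hβ2).const_mul 2)).mono'
    (by fun_prop) (Eventually.of_forall fun z => ?_)
  rw [Real.norm_of_nonneg (by positivity)]
  exact norm_sub_sq_le_two_mul _ _

theorem lintegral_cost_eq (h : Integrable (fun z => ‖z.1 - z.2‖ ^ 2) π) :
    ∫⁻ z, ENNReal.ofReal (‖z.1 - z.2‖ ^ 2) ∂π = ENNReal.ofReal (∫ z, ‖z.1 - z.2‖ ^ 2 ∂π) :=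
  (ofReal_integral_eq_lintegral_ofReal h (Eventually.of_forall fun _ => by positivity)).symm

/-- If all integrals converge, the primal objective of a plan is a real number. -/
theorem primalObjective_eq_coe (hC : Integrable (fun z => ‖z.1 - z.2‖ ^ 2) π) {h : ℝ}
    (hh : relEntropy π (m₁.prod m₂) = (h : EReal)) :
    primalObjective ε m₁ m₂ π = ((∫ z, ‖z.1 - z.2‖ ^ 2 ∂π + ε * h : ℝ) : EReal) := by
  rw [primalObjective, hh, lintegral_cost_eq hC, EReal.coe_ennreal_ofReal,
    max_eq_left (integral_nonneg fun _ => by positivity)]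
  push_cast; rfl

theorem dualObjective_eq_coe {u v : Eucl d → ℝ}
    (hfin : ∫⁻ z, ENNReal.ofReal (Real.exp ((u z.1 + v z.2 - ‖z.1 - z.2‖ ^ 2) / ε))
      ∂(m₁.prod m₂) ≠ ∞) :
    dualObjective ε m₁ m₂ α β u v = ((∫ x, u x ∂α + ∫ y, v y ∂β + ε - ε *
      (∫⁻ z, ENNReal.ofReal (Real.exp ((u z.1 + v z.2 - ‖z.1 - z.2‖ ^ 2) / ε))
      ∂(m₁.prod m₂)).toReal : ℝ) : EReal) := by
  rw [dualObjective, ← EReal.coe_ennreal_toReal hfin]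
  push_cast; rfl

/-- Weak duality: the dual objective lies below the primal objective of every plan. -/
theorem dualObjective_le_primalObjective [SigmaFinite m₁] [SigmaFinite m₂]
    [IsProbabilityMeasure α] (hε : 0 < ε) (hπ : IsTransportPlan α β π) {u v : Eucl d → ℝ}
    (hu : Integrable u α) (hv : Integrable v β) :
    dualObjective ε m₁ m₂ α β u v ≤ primalObjective ε m₁ m₂ π := by
  have := hπ.isProbabilityMeasure
  by_cases hfin : ∫⁻ z, ENNReal.ofReal (Real.exp ((u z.1 + v z.2 - ‖z.1 - z.2‖ ^ 2) / ε))
      ∂(m₁.prod m₂) = ∞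
  · rw [dualObjective, hfin, EReal.coe_ennreal_top, EReal.coe_mul_top_of_pos hε, EReal.sub_top]
    exact bot_le
  by_cases hC : ∫⁻ z, ENNReal.ofReal (‖z.1 - z.2‖ ^ 2) ∂π = ∞
  · have : primalObjective ε m₁ m₂ π = ⊤ := by
      rw [primalObjective, hC, EReal.coe_ennreal_top]
      refine EReal.top_add_of_ne_bot ?_
      rw [relEntropy]
      split_ifs
      · exact EReal.coe_ne_bot _
      · rw [EReal.coe_mul_top_of_pos hε]; exact top_ne_bot
    rw [this]; exact le_top
  by_cases hE : π ≪ m₁.prod m₂ ∧ Integrable (llr π (m₁.prod m₂)) π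
  · have hCint : Integrable (fun z => ‖z.1 - z.2‖ ^ 2) π := by
      refine ⟨by fun_prop, ?_⟩
      rw [hasFiniteIntegral_iff_ofReal (Eventually.of_forall fun _ => by positivity)]
      exact lt_top_iff_ne_top.2 hC
    have huv : Integrable (fun z => u z.1 + v z.2) π :=
      (hπ.integrable_fst hu).add (hπ.integrable_snd hv)
    have hW : Integrable (fun z => (u z.1 + v z.2 - ‖z.1 - z.2‖ ^ 2) / ε) π :=
      (huv.sub hCint).div_const ε
    have key := integral_sub_integral_llr_le hE.1 hE.2 hW hfin
    have hWint : ∫ z, (u z.1 + v z.2 - ‖z.1 - z.2‖ ^ 2) / ε ∂π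
        = (∫ x, u x ∂α + ∫ y, v y ∂β - ∫ z, ‖z.1 - z.2‖ ^ 2 ∂π) / ε := by
      rw [integral_div, integral_sub huv hCint,
        integral_add (hπ.integrable_fst hu) (hπ.integrable_snd hv), hπ.integral_fst hu,
        hπ.integral_snd hv]
    rw [dualObjective_eq_coe hfin, primalObjective_eq_coe hCint (by rw [relEntropy, if_pos hE]),
      EReal.coe_le_coe_iff]
    rw [hWint] at key
    have := mul_le_mul_of_nonneg_left key hε.le
    rw [mul_add, mul_sub, mul_div_cancel₀ _ hε.ne'] at this
    linarith
  · have : primalObjective ε m₁ m₂ π = ⊤ := by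
      rw [primalObjective, relEntropy, if_neg hE, EReal.coe_mul_top_of_pos hε]
      exact EReal.add_top_of_ne_bot (EReal.coe_ennreal_ne_bot _)
    rw [this]; exact le_top

theorem dualObjective_le_entropicOT [SigmaFinite m₁] [SigmaFinite m₂]
    [IsProbabilityMeasure α] (hε : 0 < ε) {u v : Eucl d → ℝ}
    (hu : Integrable u α) (hv : Integrable v β) :
    dualObjective ε m₁ m₂ α β u v ≤ entropicOT ε m₁ m₂ α β :=
  le_iInf₂ fun _ hπ => dualObjective_le_primalObjective hε hπ hu hv

end Plan

/-- The density `exp ((f(x) + g(y) - ‖x - y‖²) / ε)`. -/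
noncomputable def gibbsDensity {d : ℕ} (ε : ℝ) (f g : Eucl d → ℝ) (z : Eucl d × Eucl d) : ℝ :=
  Real.exp ((f z.1 + g z.2 - ‖z.1 - z.2‖ ^ 2) / ε)

/-- The measure with density `exp ((f(x) + g(y) - ‖x - y‖²) / ε)` with respect to `m₁ ⊗ m₂`. -/
noncomputable def gibbsPlan {d : ℕ} (ε : ℝ) (m₁ m₂ : Measure (Eucl d)) (f g : Eucl d → ℝ) :
    Measure (Eucl d × Eucl d) :=
  (m₁.prod m₂).withDensity fun z => ENNReal.ofReal (gibbsDensity ε f g z)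

section Gibbs

variable {d : ℕ} {ε : ℝ} {m₁ m₂ α β : Measure (Eucl d)} {f g : Eucl d → ℝ}

theorem gibbsDensity_pos (z : Eucl d × Eucl d) : 0 < gibbsDensity ε f g z := Real.exp_pos _

theorem log_gibbsDensity (z : Eucl d × Eucl d) :
    Real.log (gibbsDensity ε f g z) = (f z.1 + g z.2 - ‖z.1 - z.2‖ ^ 2) / ε := Real.log_exp _

theorem measurable_gibbsDensity (hf : Measurable f) (hg : Measurable g) :
    Measurable (gibbsDensity ε f g) := by
  unfold gibbsDensity; fun_prop

theorem integrable_gibbsPlan_iff (hf : Measurable f) (hg : Measurable g)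
    {h : Eucl d × Eucl d → ℝ} :
    Integrable h (gibbsPlan ε m₁ m₂ f g)
      ↔ Integrable (fun z => gibbsDensity ε f g z * h z) (m₁.prod m₂) := by
  rw [gibbsPlan, integrable_withDensity_iff_integrable_smul'
    (measurable_gibbsDensity hf hg).ennreal_ofReal
    (Eventually.of_forall fun _ => ENNReal.ofReal_lt_top)]
  simp only [ENNReal.toReal_ofReal (gibbsDensity_pos _).le, smul_eq_mul]

theorem integral_gibbsPlan (hf : Measurable f) (hg : Measurable g)
    (h : Eucl d × Eucl d → ℝ) :
    ∫ z, h z ∂(gibbsPlan ε m₁ m₂ f g) = ∫ z, gibbsDensity ε f g z * h z ∂(m₁.prod m₂) := by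
  rw [gibbsPlan, integral_withDensity_eq_integral_toReal_smul
    (measurable_gibbsDensity hf hg).ennreal_ofReal
    (Eventually.of_forall fun _ => ENNReal.ofReal_lt_top)]
  simp only [ENNReal.toReal_ofReal (gibbsDensity_pos _).le, smul_eq_mul]

/-- The potentials of a Gibbs plan between `α` and `β` compute its primal objective. -/
theorem primalObjective_gibbsPlan [SigmaFinite m₁] [SigmaFinite m₂] (hε : 0 < ε)
    (hf : Measurable f) (hg : Measurable g)
    (hfα : Integrable f α) (hgβ : Integrable g β)
    (hα2 : Integrable (fun x => ‖x‖ ^ 2) α) (hβ2 : Integrable (fun x => ‖x‖ ^ 2) β)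
    (hπ : IsTransportPlan α β (gibbsPlan ε m₁ m₂ f g)) :
    primalObjective ε m₁ m₂ (gibbsPlan ε m₁ m₂ f g)
      = ((∫ x, f x ∂α + ∫ y, g y ∂β : ℝ) : EReal) := by
  have hC := hπ.integrable_cost hα2 hβ2
  have huv : Integrable (fun z => f z.1 + g z.2) (gibbsPlan ε m₁ m₂ f g) :=
    (hπ.integrable_fst hfα).add (hπ.integrable_snd hgβ)
  have hL : Integrable (fun z => Real.log (gibbsDensity ε f g z)) (gibbsPlan ε m₁ m₂ f g) := by
    simp only [log_gibbsDensity]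
    exact (huv.sub hC).div_const ε
  have hE := relEntropy_withDensity (m₁.prod m₂) (measurable_gibbsDensity (ε := ε) hf hg)
    (fun z => (gibbsDensity_pos z).le) ((integrable_gibbsPlan_iff hf hg).1 hL)
  rw [primalObjective_eq_coe hC hE, ← integral_gibbsPlan hf hg]
  simp only [log_gibbsDensity]
  rw [integral_div, integral_sub huv hC,
    integral_add (hπ.integrable_fst hfα) (hπ.integrable_snd hgβ), hπ.integral_fst hfα,
    hπ.integral_snd hgβ, mul_div_cancel₀ _ hε.ne']
  congr 1; ring

theorem lintegral_gibbsDensity_eq_one [IsProbabilityMeasure α]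
    (hπ : IsTransportPlan α β (gibbsPlan ε m₁ m₂ f g)) :
    ∫⁻ z, ENNReal.ofReal (Real.exp ((f z.1 + g z.2 - ‖z.1 - z.2‖ ^ 2) / ε))
      ∂(m₁.prod m₂) = 1 := by
  have := hπ.isProbabilityMeasure.measure_univ
  rwa [gibbsPlan, withDensity_apply _ MeasurableSet.univ, Measure.restrict_univ] at this

/-- Potentials of a Gibbs plan of mass one make the exponential term of the dual objective cancel,
for all measures `α'`, `β'` and not only for the marginals of the plan. -/
theorem dualObjective_eq_of_gibbsPlan [IsProbabilityMeasure α]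
    (hπ : IsTransportPlan α β (gibbsPlan ε m₁ m₂ f g)) (α' β' : Measure (Eucl d)) :
    dualObjective ε m₁ m₂ α' β' f g = ((∫ x, f x ∂α' + ∫ y, g y ∂β' : ℝ) : EReal) := by
  have hone := lintegral_gibbsDensity_eq_one hπ
  rw [dualObjective_eq_coe (by rw [hone]; exact ENNReal.one_ne_top), hone]
  simp

/-- Strong duality: if the Gibbs plan of `(f, g)` couples `α` and `β`, it attains the value of the
weak duality bound for `(f, g)`, so the plan and the potentials are both optimal. -/
theorem isDualOptimal_of_gibbsPlan [SigmaFinite m₁] [SigmaFinite m₂]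
    [IsProbabilityMeasure α] (hε : 0 < ε) (hf : Measurable f)
    (hg : Measurable g) (hfα : Integrable f α) (hgβ : Integrable g β)
    (hα2 : Integrable (fun x => ‖x‖ ^ 2) α) (hβ2 : Integrable (fun x => ‖x‖ ^ 2) β)
    (hπ : IsTransportPlan α β (gibbsPlan ε m₁ m₂ f g)) :
    IsDualOptimal ε m₁ m₂ α β f g ∧
      entropicOT ε m₁ m₂ α β = ((∫ x, f x ∂α + ∫ y, g y ∂β : ℝ) : EReal) := by
  have hP := primalObjective_gibbsPlan hε hf hg hfα hgβ hα2 hβ2 hπ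
  have hD := dualObjective_eq_of_gibbsPlan hπ α β
  refine ⟨⟨hfα, hgβ, fun u v hu hv => ?_⟩, le_antisymm ?_ ?_⟩
  · rw [hD, ← hP]
    exact dualObjective_le_primalObjective hε hπ hu hv
  · rw [← hP]
    exact entropicOT_le_primalObjective hπ
  · rw [← hD]
    exact dualObjective_le_entropicOT hε hfα hgβ

end Gibbs

/-! ### The soft transform on sub-Gaussian measures -/

/-- Some exponential moment of the squared norm is finite. -/
def HasGaussianTail {d : ℕ} (μ : Measure (Eucl d)) : Prop :=
  ∃ c : ℝ, 0 < c ∧ Integrable (fun x => Real.exp (c * ‖x‖ ^ 2)) μ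

theorem SubGaussian.hasGaussianTail {d : ℕ} {σ : ℝ} {μ : Measure (Eucl d)} (hσ : 0 < σ)
    (h : SubGaussian σ μ) : HasGaussianTail μ := by
  have hI : Integrable (fun x => Real.exp (‖x‖ ^ 2 / (2 * d * σ ^ 2))) μ := by
    refine ⟨by fun_prop, ?_⟩
    rw [hasFiniteIntegral_iff_ofReal (Eventually.of_forall fun _ => (Real.exp_pos _).le)]
    exact lt_of_le_of_lt h (by norm_num)
  rcases Nat.eq_zero_or_pos d with rfl | hd
  -- in dimension zero the norm vanishes, and the coefficient `1 / (2 d σ²)` is the junk value `0`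
  · refine ⟨1, one_pos, hI.congr (Eventually.of_forall fun x => ?_)⟩
    simp [Subsingleton.elim x 0]
  · have hd' : (0 : ℝ) < d := by exact_mod_cast hd
    refine ⟨1 / (2 * d * σ ^ 2), by positivity, hI.congr (Eventually.of_forall fun x => ?_)⟩
    simp only
    congr 1; ring

section Tail

variable {d : ℕ} {μ : Measure (Eucl d)}

theorem exp_mul_norm_le {c : ℝ} (hc : 0 < c) (L : ℝ) (x : Eucl d) :
    Real.exp (L * ‖x‖) ≤ Real.exp (L ^ 2 / (4 * c)) * Real.exp (c * ‖x‖ ^ 2) := by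
  rw [← Real.exp_add]
  refine Real.exp_le_exp.2 ?_
  have : L ^ 2 / (4 * c) + c * ‖x‖ ^ 2 - L * ‖x‖ = (L - 2 * c * ‖x‖) ^ 2 / (4 * c) := by
    field_simp; ring
  have h2 : 0 ≤ (L - 2 * c * ‖x‖) ^ 2 / (4 * c) := by positivity
  linarith

theorem HasGaussianTail.integrable_exp (h : HasGaussianTail μ) (L : ℝ) :
    Integrable (fun x => Real.exp (L * ‖x‖)) μ := by
  obtain ⟨c, hc, hI⟩ := h
  refine (hI.const_mul (Real.exp (L ^ 2 / (4 * c)))).mono' (by fun_prop)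
    (Eventually.of_forall fun x => ?_)
  rw [Real.norm_of_nonneg (Real.exp_pos _).le]
  exact exp_mul_norm_le hc L x

theorem HasGaussianTail.integrable_sq (h : HasGaussianTail μ) :
    Integrable (fun x => ‖x‖ ^ 2) μ := by
  obtain ⟨c, hc, hI⟩ := h
  refine (hI.const_mul (1 / c)).mono' (by fun_prop) (Eventually.of_forall fun x => ?_)
  rw [Real.norm_of_nonneg (by positivity), one_div_mul_eq_div, le_div_iff₀ hc]
  have := Real.add_one_le_exp (c * ‖x‖ ^ 2)
  linarith

theorem HasGaussianTail.integrable_norm (h : HasGaussianTail μ) :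
    Integrable (fun x => ‖x‖) μ := by
  refine (h.integrable_exp 1).mono' (by fun_prop) (Eventually.of_forall fun x => ?_)
  rw [norm_norm, one_mul]
  have := Real.add_one_le_exp ‖x‖
  linarith

end Tail

/-- The soft transform `y ↦ -ε log ∫ exp ((u(x) - ‖x - y‖²) / ε) dμ(x)` of `u`. Product potentials
are the pairs of integrable functions that are soft transforms of each other. -/
noncomputable def softTransform {d : ℕ} (ε : ℝ) (μ : Measure (Eucl d)) (u : Eucl d → ℝ)
    (y : Eucl d) : ℝ :=
  -ε * Real.log (∫ x, Real.exp ((u x - ‖x - y‖ ^ 2) / ε) ∂μ)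

/-- The growth bounds of potentials: quadratic from below, and from above affine in the norm after
subtraction of `‖x‖²`. The upper bound is what makes `exp ((u(x) - ‖x - y‖²) / ε)` integrable
against measures with Gaussian tails, whatever the rate of the tail. -/
structure IsTame {d : ℕ} (K : ℝ) (u : Eucl d → ℝ) : Prop where
  measurable : Measurable u
  lower : ∀ x, -(K * (1 + ‖x‖ ^ 2)) ≤ u x
  upper : ∀ x, u x ≤ ‖x‖ ^ 2 + K * (1 + ‖x‖)

section Transform

variable {d : ℕ} {ε : ℝ} {μ : Measure (Eucl d)} {u : Eucl d → ℝ} {K : ℝ}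

theorem sub_sq_norm_sub_le (hK : ∀ x, u x ≤ ‖x‖ ^ 2 + K * (1 + ‖x‖)) (x y : Eucl d) :
    u x - ‖x - y‖ ^ 2 ≤ K + (K + 2 * ‖y‖) * ‖x‖ := by
  have h1 := hK x
  have h2 : (‖x‖ - ‖y‖) ^ 2 ≤ ‖x - y‖ ^ 2 := by
    rw [← sq_abs]
    exact pow_le_pow_left₀ (abs_nonneg _) (abs_norm_sub_norm_le x y) 2
  nlinarith [sq_nonneg ‖y‖]

theorem exp_sub_sq_le (hε : 0 < ε) (hK : ∀ x, u x ≤ ‖x‖ ^ 2 + K * (1 + ‖x‖)) (x y : Eucl d) :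
    Real.exp ((u x - ‖x - y‖ ^ 2) / ε)
      ≤ Real.exp (K / ε) * Real.exp ((K + 2 * ‖y‖) / ε * ‖x‖) := by
  rw [← Real.exp_add]
  refine Real.exp_le_exp.2 ?_
  have := div_le_div_of_nonneg_right (sub_sq_norm_sub_le hK x y) hε.le
  refine this.trans (le_of_eq ?_)
  ring

theorem HasGaussianTail.integrable_kernel (hμ : HasGaussianTail μ) (hε : 0 < ε)
    (hu : AEStronglyMeasurable u μ) (hK : ∀ x, u x ≤ ‖x‖ ^ 2 + K * (1 + ‖x‖)) (y : Eucl d) :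
    Integrable (fun x => Real.exp ((u x - ‖x - y‖ ^ 2) / ε)) μ := by
  refine ((hμ.integrable_exp ((K + 2 * ‖y‖) / ε)).const_mul (Real.exp (K / ε))).mono' ?_
    (Eventually.of_forall fun x => ?_)
  · refine Real.continuous_exp.comp_aestronglyMeasurable ?_
    simp only [div_eq_mul_inv]
    exact (hu.sub (by fun_prop)).mul_const _
  · rw [Real.norm_of_nonneg (Real.exp_pos _).le]
    exact exp_sub_sq_le hε hK x y

theorem exp_softTransform [NeZero μ] (hε : 0 < ε) {y : Eucl d}
    (h : Integrable (fun x => Real.exp ((u x - ‖x - y‖ ^ 2) / ε)) μ) :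
    Real.exp (softTransform ε μ u y / ε) * ∫ x, Real.exp ((u x - ‖x - y‖ ^ 2) / ε) ∂μ = 1 := by
  have hpos := integral_exp_pos h
  rw [softTransform, neg_mul, neg_div, mul_div_cancel_left₀ _ hε.ne', Real.exp_neg,
    Real.exp_log hpos, inv_mul_cancel₀ hpos.ne']

theorem softTransform_congr {v : Eucl d → ℝ} (h : u =ᵐ[μ] v) :
    softTransform ε μ u = softTransform ε μ v := by
  funext y
  unfold softTransform
  congr 2
  refine integral_congr_ae ?_
  filter_upwards [h] with x hx
  rw [hx]

theorem softTransform_add_const [NeZero μ] (hε : 0 < ε)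
    (h : ∀ y, Integrable (fun x => Real.exp ((u x - ‖x - y‖ ^ 2) / ε)) μ) (c : ℝ) :
    softTransform ε μ (fun x => u x + c) = fun y => softTransform ε μ u y - c := by
  funext y
  have hpos := integral_exp_pos (h y)
  have : ∀ x, Real.exp ((u x + c - ‖x - y‖ ^ 2) / ε)
      = Real.exp (c / ε) * Real.exp ((u x - ‖x - y‖ ^ 2) / ε) := fun x => by
    rw [← Real.exp_add]; congr 1; ring
  simp only [softTransform, this]
  rw [integral_const_mul, Real.log_mul (Real.exp_pos _).ne' hpos.ne', Real.log_exp]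
  field_simp; ring

theorem measurable_softTransform [SFinite μ] (hu : Measurable u) :
    Measurable (softTransform ε μ u) := by
  refine (Real.measurable_log.comp ?_).const_mul (-ε)
  refine StronglyMeasurable.measurable ?_
  refine StronglyMeasurable.integral_prod_right
    (f := fun y x => Real.exp ((u x - ‖x - y‖ ^ 2) / ε)) ?_
  exact Measurable.stronglyMeasurable (by fun_prop)

/-- An upper bound on a function gives a lower bound on its soft transform, uniformly. -/
theorem HasGaussianTail.softTransform_lower (hμ : HasGaussianTail μ) [NeZero μ] (hε : 0 < ε)
    (K : ℝ) : ∃ K', ∀ u : Eucl d → ℝ, AEStronglyMeasurable u μ →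
      (∀ x, u x ≤ ‖x‖ ^ 2 + K * (1 + ‖x‖)) →
      ∀ y, -(K' * (1 + ‖y‖ ^ 2)) ≤ softTransform ε μ u y := by
  obtain ⟨c, hc, hI⟩ := id hμ
  set M := ∫ x, Real.exp (c * ‖x‖ ^ 2) ∂μ with hM
  have hMpos : 0 < M := integral_exp_pos hI
  refine ⟨|K| + K ^ 2 / (2 * c * ε) + 2 / (c * ε) + ε * |Real.log M|, fun u hu hK y => ?_⟩
  have hker := hμ.integrable_kernel hε hu hK y
  have hle : ∫ x, Real.exp ((u x - ‖x - y‖ ^ 2) / ε) ∂μ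
      ≤ Real.exp (K / ε + ((K + 2 * ‖y‖) / ε) ^ 2 / (4 * c)) * M := by
    rw [hM, ← integral_const_mul]
    refine integral_mono hker (hI.const_mul _) fun x => ?_
    refine (exp_sub_sq_le hε hK x y).trans ?_
    rw [Real.exp_add, mul_assoc]
    exact mul_le_mul_of_nonneg_left (exp_mul_norm_le hc _ x) (Real.exp_pos _).le
  have hlog := Real.log_le_log (integral_exp_pos hker) hle
  rw [Real.log_mul (Real.exp_pos _).ne' hMpos.ne', Real.log_exp] at hlog
  have h1 : ε * (K / ε + ((K + 2 * ‖y‖) / ε) ^ 2 / (4 * c) + Real.log M)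
      ≤ (|K| + K ^ 2 / (2 * c * ε) + 2 / (c * ε) + ε * |Real.log M|) * (1 + ‖y‖ ^ 2) := by
    have e1 : ε * (K / ε + ((K + 2 * ‖y‖) / ε) ^ 2 / (4 * c) + Real.log M)
        = K + (K + 2 * ‖y‖) ^ 2 / (4 * c * ε) + ε * Real.log M := by field_simp
    have e2 : (K + 2 * ‖y‖) ^ 2 / (4 * c * ε)
        ≤ K ^ 2 / (2 * c * ε) + 2 / (c * ε) * ‖y‖ ^ 2 := by
      have : K ^ 2 / (2 * c * ε) + 2 / (c * ε) * ‖y‖ ^ 2 - (K + 2 * ‖y‖) ^ 2 / (4 * c * ε)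
          = (K - 2 * ‖y‖) ^ 2 / (4 * c * ε) := by field_simp; ring
      have h2 : 0 ≤ (K - 2 * ‖y‖) ^ 2 / (4 * c * ε) := by positivity
      linarith
    have e3 : ε * Real.log M ≤ ε * |Real.log M| :=
      mul_le_mul_of_nonneg_left (le_abs_self _) hε.le
    have p1 : 0 ≤ |K| * ‖y‖ ^ 2 := by positivity
    have p2 : 0 ≤ K ^ 2 / (2 * c * ε) * ‖y‖ ^ 2 := by positivity
    have p3 : 0 ≤ 2 / (c * ε) := by positivity
    have p4 : 0 ≤ ε * |Real.log M| * ‖y‖ ^ 2 := by positivity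
    rw [e1]
    nlinarith [le_abs_self K]
  have h2 := mul_le_mul_of_nonneg_left hlog hε.le
  rw [softTransform]
  linarith

/-- A lower bound on the mean of a function gives an upper bound on its soft transform, by Jensen's
inequality. -/
theorem HasGaussianTail.softTransform_upper (hμ : HasGaussianTail μ) [IsProbabilityMeasure μ]
    (hε : 0 < ε) (M : ℝ) : ∃ K', ∀ u : Eucl d → ℝ, Integrable u μ →
      (∀ y, Integrable (fun x => Real.exp ((u x - ‖x - y‖ ^ 2) / ε)) μ) →
      -M ≤ ∫ x, u x ∂μ → ∀ y, softTransform ε μ u y ≤ ‖y‖ ^ 2 + K' * (1 + ‖y‖) := by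
  refine ⟨|M| + ∫ x, ‖x‖ ^ 2 ∂μ + 2 * ∫ x, ‖x‖ ∂μ, fun u hu hker hM y => ?_⟩
  have h2 := hμ.integrable_sq
  have h1 := hμ.integrable_norm
  have hbound : Integrable (fun x => ‖x‖ ^ 2 + 2 * ‖y‖ * ‖x‖ + ‖y‖ ^ 2) μ :=
    (h2.add (h1.const_mul _)).add (integrable_const _)
  have hle : ∀ x : Eucl d, ‖x - y‖ ^ 2 ≤ ‖x‖ ^ 2 + 2 * ‖y‖ * ‖x‖ + ‖y‖ ^ 2 := fun x => by
    have := pow_le_pow_left₀ (norm_nonneg _) (norm_sub_le x y) 2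
    nlinarith
  have hC : Integrable (fun x => ‖x - y‖ ^ 2) μ := by
    refine hbound.mono' (by fun_prop) (Eventually.of_forall fun x => ?_)
    rw [Real.norm_of_nonneg (by positivity)]
    exact hle x
  have hCle : ∫ x, ‖x - y‖ ^ 2 ∂μ
      ≤ ∫ x, ‖x‖ ^ 2 ∂μ + 2 * ‖y‖ * ∫ x, ‖x‖ ∂μ + ‖y‖ ^ 2 := by
    refine (integral_mono hC hbound hle).trans (le_of_eq ?_)
    rw [integral_add (f := fun x => ‖x‖ ^ 2 + 2 * ‖y‖ * ‖x‖) (h2.add (h1.const_mul _))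
      (integrable_const _), integral_add h2 (h1.const_mul _), integral_const_mul]
    simp
  have huC : Integrable (fun x => (u x - ‖x - y‖ ^ 2) / ε) μ := (hu.sub hC).div_const ε
  have hJ : Real.exp (∫ x, (u x - ‖x - y‖ ^ 2) / ε ∂μ)
      ≤ ∫ x, Real.exp ((u x - ‖x - y‖ ^ 2) / ε) ∂μ :=
    convexOn_exp.map_integral_le Real.continuous_exp.continuousOn isClosed_univ
      (Eventually.of_forall fun _ => Set.mem_univ _) huC (hker y)
  have hlog := Real.log_le_log (Real.exp_pos _) hJ
  rw [Real.log_exp, integral_div, integral_sub hu hC] at hlog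
  have h3 := mul_le_mul_of_nonneg_left hlog hε.le
  rw [mul_div_cancel₀ _ hε.ne'] at h3
  have p1 : 0 ≤ ∫ x, ‖x‖ ∂μ := integral_nonneg fun _ => norm_nonneg _
  have p2 : 0 ≤ ∫ x, ‖x‖ ^ 2 ∂μ := integral_nonneg fun _ => by positivity
  rw [softTransform]
  nlinarith [norm_nonneg y, le_abs_self M, abs_nonneg M, mul_nonneg p2 (norm_nonneg y),
    mul_nonneg (abs_nonneg M) (norm_nonneg y)]

theorem IsTame.nonneg (h : IsTame K u) : 0 ≤ K := by
  have h1 := h.lower 0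
  have h2 := h.upper 0
  simp only [norm_zero] at h1 h2
  linarith

theorem IsTame.mono {K' : ℝ} (h : IsTame K u) (hK : K ≤ K') : IsTame K' u where
  measurable := h.measurable
  lower x := by nlinarith [h.lower x, sq_nonneg ‖x‖]
  upper x := by nlinarith [h.upper x, norm_nonneg x]

theorem IsTame.abs_le_mul (h : IsTame K u) (x : Eucl d) :
    |u x| ≤ (1 + 2 * K) * (1 + ‖x‖ ^ 2) := by
  have hK := h.nonneg
  have h1 := h.lower x
  have h2 := h.upper x
  have h3 : 1 + ‖x‖ ≤ 2 * (1 + ‖x‖ ^ 2) := by nlinarith [sq_nonneg (‖x‖ - 1), sq_nonneg ‖x‖]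
  have h4 := mul_le_mul_of_nonneg_left h3 hK
  have h5 : 0 ≤ K * (1 + ‖x‖ ^ 2) := by positivity
  refine abs_le.2 ⟨?_, ?_⟩ <;> nlinarith [sq_nonneg ‖x‖]

theorem HasGaussianTail.integrable_one_add_sq [IsFiniteMeasure μ] (hμ : HasGaussianTail μ)
    (c : ℝ) : Integrable (fun x => c * (1 + ‖x‖ ^ 2)) μ :=
  ((integrable_const (1 : ℝ)).add hμ.integrable_sq).const_mul _

theorem IsTame.integrable [IsFiniteMeasure μ] (hμ : HasGaussianTail μ) (h : IsTame K u) :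
    Integrable u μ :=
  (hμ.integrable_one_add_sq (1 + 2 * K)).mono' h.measurable.aestronglyMeasurable
    (Eventually.of_forall fun x => h.abs_le_mul x)

theorem IsTame.integrable_kernel (hμ : HasGaussianTail μ) (hε : 0 < ε) (h : IsTame K u)
    (y : Eucl d) : Integrable (fun x => Real.exp ((u x - ‖x - y‖ ^ 2) / ε)) μ :=
  hμ.integrable_kernel hε h.measurable.aestronglyMeasurable h.upper y

theorem IsTame.add_const (h : IsTame K u) (c : ℝ) : IsTame (K + |c|) (fun x => u x + c) where
  measurable := h.measurable.add_const c
  lower x := by nlinarith [h.lower x, neg_abs_le c, mul_nonneg (abs_nonneg c) (sq_nonneg ‖x‖)]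
  upper x := by nlinarith [h.upper x, le_abs_self c, mul_nonneg (abs_nonneg c) (norm_nonneg x)]

theorem IsTame.midpoint {K' : ℝ} {v : Eucl d → ℝ} (hu : IsTame K u) (hv : IsTame K' v) :
    IsTame ((K + K') / 2) (fun x => (u x + v x) / 2) where
  measurable := (hu.measurable.add hv.measurable).div_const 2
  lower x := by linarith [hu.lower x, hv.lower x]
  upper x := by linarith [hu.upper x, hv.upper x]

/-- The soft transform preserves the growth bounds, with constants that depend only on the upper
bound and on the mean. -/
theorem HasGaussianTail.isTame_softTransform (hμ : HasGaussianTail μ) [IsProbabilityMeasure μ]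
    (hε : 0 < ε) (K M : ℝ) : ∃ K', ∀ u : Eucl d → ℝ, Measurable u → Integrable u μ →
      (∀ x, u x ≤ ‖x‖ ^ 2 + K * (1 + ‖x‖)) → -M ≤ ∫ x, u x ∂μ →
      IsTame K' (softTransform ε μ u) := by
  obtain ⟨K₁, h₁⟩ := hμ.softTransform_lower hε K
  obtain ⟨K₂, h₂⟩ := hμ.softTransform_upper hε M
  refine ⟨max K₁ K₂, fun u hum hui hK hM => ⟨measurable_softTransform hum, fun x => ?_,
    fun x => ?_⟩⟩
  · have := h₁ u hum.aestronglyMeasurable hK x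
    nlinarith [le_max_left K₁ K₂, sq_nonneg ‖x‖]
  · have := h₂ u hui (hμ.integrable_kernel hε hum.aestronglyMeasurable hK) hM x
    nlinarith [le_max_right K₁ K₂, norm_nonneg x]

/-- The soft transform is continuous along sequences that converge almost everywhere under a
common growth bound. -/
theorem tendsto_softTransform (hμ : HasGaussianTail μ) [NeZero μ] (hε : 0 < ε)
    {v : ℕ → Eucl d → ℝ} {w : Eucl d → ℝ} (hv : ∀ n, Measurable (v n)) (hw : Measurable w)
    (hK : ∀ n x, v n x ≤ ‖x‖ ^ 2 + K * (1 + ‖x‖))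
    (hlim : ∀ᵐ x ∂μ, Tendsto (fun n => v n x) atTop (𝓝 (w x))) (y : Eucl d) :
    Tendsto (fun n => softTransform ε μ (v n) y) atTop (𝓝 (softTransform ε μ w y)) := by
  have hdom := (hμ.integrable_exp ((K + 2 * ‖y‖) / ε)).const_mul (Real.exp (K / ε))
  have hlimexp : ∀ᵐ x ∂μ, Tendsto (fun n => Real.exp ((v n x - ‖x - y‖ ^ 2) / ε)) atTop
      (𝓝 (Real.exp ((w x - ‖x - y‖ ^ 2) / ε))) := by
    filter_upwards [hlim] with x hx
    exact (Real.continuous_exp.tendsto _).comp ((hx.sub_const _).div_const ε)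
  have hwint : Integrable (fun x => Real.exp ((w x - ‖x - y‖ ^ 2) / ε)) μ := by
    refine hdom.mono' (by fun_prop) ?_
    filter_upwards [hlimexp] with x hx
    rw [Real.norm_of_nonneg (Real.exp_pos _).le]
    exact le_of_tendsto' hx fun n => exp_sub_sq_le hε (hK n) x y
  have hint : Tendsto (fun n => ∫ x, Real.exp ((v n x - ‖x - y‖ ^ 2) / ε) ∂μ) atTop
      (𝓝 (∫ x, Real.exp ((w x - ‖x - y‖ ^ 2) / ε) ∂μ)) := by
    refine tendsto_integral_of_dominated_convergence _
      (fun n => ?_) hdom (fun n => Eventually.of_forall fun x => ?_) hlimexp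
    · have := hv n
      exact Measurable.aestronglyMeasurable (by fun_prop)
    · rw [Real.norm_of_nonneg (Real.exp_pos _).le]
      exact exp_sub_sq_le hε (hK n) x y
  exact (hint.log (integral_exp_pos hwint).ne').const_mul (-ε)

end Transform

/-! ### The dual problem on tame potentials -/

/-- The dual objective with the product of the marginals as reference, as a real number. It is
meaningful where `gibbsDensity ε u v` is integrable. -/
noncomputable def dualValue {d : ℕ} (ε : ℝ) (α β : Measure (Eucl d)) (u v : Eucl d → ℝ) : ℝ :=
  ∫ x, u x ∂α + ∫ y, v y ∂β - ε * ∫ z, gibbsDensity ε u v z ∂(α.prod β) + ε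

/-- Pairs of tame functions with a finite dual objective. The integrability is a separate
condition: tame functions alone allow the growth `exp (2⟪x, y⟫ / ε)`. -/
structure IsAdmissible {d : ℕ} (ε : ℝ) (α β : Measure (Eucl d)) (u v : Eucl d → ℝ) : Prop where
  fst : ∃ K, IsTame K u
  snd : ∃ K, IsTame K v
  integrable : Integrable (gibbsDensity ε u v) (α.prod β)

section DualValue

variable {d : ℕ} {ε : ℝ} {α β : Measure (Eucl d)} {u v u' v' : Eucl d → ℝ} {K : ℝ}

theorem gibbsDensity_swap (z : Eucl d × Eucl d) :
    gibbsDensity ε v u z.swap = gibbsDensity ε u v z := by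
  simp only [gibbsDensity, Prod.fst_swap, Prod.snd_swap]
  rw [norm_sub_rev, add_comm (v z.2)]

theorem gibbsDensity_eq_mul (x y : Eucl d) :
    gibbsDensity ε u v (x, y)
      = Real.exp (v y / ε) * Real.exp ((u x - ‖x - y‖ ^ 2) / ε) := by
  rw [gibbsDensity, ← Real.exp_add]
  congr 1; ring

/-- The square root of the Gibbs density. -/
noncomputable def sqrtGibbs {d : ℕ} (ε : ℝ) (u v : Eucl d → ℝ) (z : Eucl d × Eucl d) : ℝ :=
  Real.exp ((u z.1 + v z.2 - ‖z.1 - z.2‖ ^ 2) / (2 * ε))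

theorem sqrtGibbs_sq (z : Eucl d × Eucl d) : sqrtGibbs ε u v z ^ 2 = gibbsDensity ε u v z := by
  rw [sqrtGibbs, gibbsDensity, ← Real.exp_nat_mul]
  congr 1; push_cast; field_simp

theorem sqrtGibbs_mul (z : Eucl d × Eucl d) :
    sqrtGibbs ε u v z * sqrtGibbs ε u' v' z
      = gibbsDensity ε (fun x => (u x + u' x) / 2) (fun y => (v y + v' y) / 2) z := by
  rw [sqrtGibbs, sqrtGibbs, gibbsDensity, ← Real.exp_add]
  congr 1; field_simp; ring

theorem measurable_sqrtGibbs (hu : Measurable u) (hv : Measurable v) :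
    Measurable (sqrtGibbs ε u v) := by
  unfold sqrtGibbs; fun_prop

theorem IsAdmissible.midpoint (h : IsAdmissible ε α β u v) (h' : IsAdmissible ε α β u' v') :
    IsAdmissible ε α β (fun x => (u x + u' x) / 2) (fun y => (v y + v' y) / 2) := by
  obtain ⟨K₁, hu⟩ := h.fst
  obtain ⟨K₂, hv⟩ := h.snd
  obtain ⟨K₃, hu'⟩ := h'.fst
  obtain ⟨K₄, hv'⟩ := h'.snd
  refine ⟨⟨_, hu.midpoint hu'⟩, ⟨_, hv.midpoint hv'⟩, ?_⟩
  refine (h.integrable.add h'.integrable).mono' (measurable_gibbsDensity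
    (hu.midpoint hu').measurable (hv.midpoint hv').measurable).aestronglyMeasurable
    (Eventually.of_forall fun z => ?_)
  rw [Real.norm_of_nonneg (gibbsDensity_pos _).le, ← sqrtGibbs_mul, Pi.add_apply,
    ← sqrtGibbs_sq, ← sqrtGibbs_sq]
  nlinarith [sq_nonneg (sqrtGibbs ε u v z - sqrtGibbs ε u' v' z),
    sq_nonneg (sqrtGibbs ε u v z), sq_nonneg (sqrtGibbs ε u' v' z)]

variable [IsProbabilityMeasure α] [IsProbabilityMeasure β]

theorem dualValue_swap : dualValue ε β α v u = dualValue ε α β u v := by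
  rw [dualValue, dualValue, ← integral_prod_swap (gibbsDensity ε v u)]
  simp only [gibbsDensity_swap]
  ring

theorem IsAdmissible.swap (h : IsAdmissible ε α β u v) : IsAdmissible ε β α v u where
  fst := h.snd
  snd := h.fst
  integrable := by
    refine h.integrable.swap.congr (Eventually.of_forall fun z => ?_)
    exact gibbsDensity_swap (u := v) (v := u) z

/-- A function and its soft transform define a measure of total mass one. -/
theorem integrable_gibbsDensity_softTransform (hα : HasGaussianTail α) (hε : 0 < ε)
    (hu : IsTame K u) : Integrable (gibbsDensity ε u (softTransform ε α u)) (α.prod β) ∧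
      ∫ z, gibbsDensity ε u (softTransform ε α u) z ∂(α.prod β) = 1 := by
  have hker := hu.integrable_kernel hα hε
  have hsec : ∀ y, ∫ x, gibbsDensity ε u (softTransform ε α u) (x, y) ∂α = 1 := fun y => by
    simp only [gibbsDensity_eq_mul]
    rw [integral_const_mul, exp_softTransform hε (hker y)]
  have hI : Integrable (gibbsDensity ε u (softTransform ε α u)) (α.prod β) := by
    rw [integrable_prod_iff' (measurable_gibbsDensity hu.measurable
      (measurable_softTransform hu.measurable)).aestronglyMeasurable]
    refine ⟨Eventually.of_forall fun y => ?_, ?_⟩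
    · simp only [gibbsDensity_eq_mul]
      exact (hker y).const_mul _
    · simp only [Real.norm_of_nonneg (gibbsDensity_pos _).le, hsec]
      exact integrable_const _
  refine ⟨hI, ?_⟩
  rw [integral_prod_symm _ hI]
  simp [hsec]

theorem dualValue_softTransform (hα : HasGaussianTail α) (hε : 0 < ε) (hu : IsTame K u) :
    dualValue ε α β u (softTransform ε α u)
      = ∫ x, u x ∂α + ∫ y, softTransform ε α u y ∂β := by
  rw [dualValue, (integrable_gibbsDensity_softTransform hα hε hu).2]
  ring

theorem exists_isTame_softTransform (hα : HasGaussianTail α) (hε : 0 < ε) (hu : IsTame K u) :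
    ∃ K', IsTame K' (softTransform ε α u) := by
  obtain ⟨K', h⟩ := hα.isTame_softTransform hε K (-∫ x, u x ∂α)
  exact ⟨K', h u hu.measurable (hu.integrable hα) hu.upper (by simp)⟩

theorem isAdmissible_softTransform (hα : HasGaussianTail α) (hε : 0 < ε) (hu : IsTame K u) :
    IsAdmissible ε α β u (softTransform ε α u) :=
  ⟨⟨K, hu⟩, exists_isTame_softTransform hα hε hu,
    (integrable_gibbsDensity_softTransform hα hε hu).1⟩

/-- The soft transform of `u` is the best partner of `u`. -/
theorem dualValue_le_softTransform (hα : HasGaussianTail α) (hβ : HasGaussianTail β) (hε : 0 < ε)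
    (h : IsAdmissible ε α β u v) :
    dualValue ε α β u v ≤ dualValue ε α β u (softTransform ε α u) := by
  obtain ⟨K, hu⟩ := h.fst
  obtain ⟨K', hv⟩ := h.snd
  obtain ⟨K'', hT⟩ := exists_isTame_softTransform hα hε hu
  have hker := hu.integrable_kernel hα hε
  have hsec : ∀ y, ∫ x, gibbsDensity ε u v (x, y) ∂α
      = Real.exp ((v y - softTransform ε α u y) / ε) := fun y => by
    have h1 := exp_softTransform hε (hker y)
    simp only [gibbsDensity_eq_mul]
    rw [integral_const_mul, sub_div, Real.exp_sub, eq_div_iff (Real.exp_pos _).ne', mul_assoc,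
      mul_comm (∫ _, _ ∂α), h1, mul_one]
  have hvT : Integrable (fun y => v y - softTransform ε α u y) β :=
    (hv.integrable hβ).sub (hT.integrable hβ)
  have hle : ∫ y, ((v y - softTransform ε α u y) / ε + 1) ∂β
      ≤ ∫ z, gibbsDensity ε u v z ∂(α.prod β) := by
    rw [integral_prod_symm _ h.integrable]
    refine integral_mono ((hvT.div_const ε).add (integrable_const _))
      h.integrable.integral_prod_right fun y => ?_
    simp only [hsec]
    exact Real.add_one_le_exp _
  rw [integral_add (hvT.div_const ε) (integrable_const _), integral_div,
    integral_sub (hv.integrable hβ) (hT.integrable hβ)] at hle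
  have h2 := mul_le_mul_of_nonneg_left hle hε.le
  rw [mul_add, mul_div_cancel₀ _ hε.ne'] at h2
  rw [dualValue_softTransform hα hε hu, dualValue]
  simp only [integral_const, probReal_univ, smul_eq_mul, mul_one] at h2
  linarith

theorem isTransportPlan_prod : IsTransportPlan α β (α.prod β) := by
  constructor <;> simp

theorem dualValue_le_cost (hα : HasGaussianTail α) (hβ : HasGaussianTail β) (hε : 0 < ε)
    (h : IsAdmissible ε α β u v) :
    dualValue ε α β u v ≤ ∫ z, ‖z.1 - z.2‖ ^ 2 ∂(α.prod β) := by
  obtain ⟨K, hu⟩ := h.fst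
  obtain ⟨K', hv⟩ := h.snd
  have hp : IsTransportPlan α β (α.prod β) := isTransportPlan_prod
  have hC := hp.integrable_cost hα.integrable_sq hβ.integrable_sq
  have iu := hp.integrable_fst (hu.integrable hα)
  have iv := hp.integrable_snd (hv.integrable hβ)
  have huv : Integrable (fun z => u z.1 + v z.2) (α.prod β) := iu.add iv
  have hW : Integrable (fun z => (u z.1 + v z.2 - ‖z.1 - z.2‖ ^ 2) / ε) (α.prod β) :=
    (huv.sub hC).div_const ε
  have hle : ∫ z, ((u z.1 + v z.2 - ‖z.1 - z.2‖ ^ 2) / ε + 1) ∂(α.prod β)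
      ≤ ∫ z, gibbsDensity ε u v z ∂(α.prod β) :=
    integral_mono (hW.add (integrable_const _)) h.integrable fun z => Real.add_one_le_exp _
  rw [integral_add hW (integrable_const _), integral_div, integral_sub huv hC,
    integral_add iu iv, hp.integral_fst (hu.integrable hα), hp.integral_snd (hv.integrable hβ)]
    at hle
  have h2 := mul_le_mul_of_nonneg_left hle hε.le
  rw [mul_add, mul_div_cancel₀ _ hε.ne'] at h2
  simp only [integral_const, probReal_univ, smul_eq_mul, mul_one] at h2
  rw [dualValue]
  linarith

/-- Quantitative strict concavity of the dual objective at midpoints: it controls the `L²` distance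
of the square roots of the Gibbs densities. -/
theorem integral_sqrtGibbs_sub_sq (hα : HasGaussianTail α) (hβ : HasGaussianTail β)
    (h : IsAdmissible ε α β u v) (h' : IsAdmissible ε α β u' v') :
    Integrable (fun z => (sqrtGibbs ε u v z - sqrtGibbs ε u' v' z) ^ 2) (α.prod β) ∧
    ε * ∫ z, (sqrtGibbs ε u v z - sqrtGibbs ε u' v' z) ^ 2 ∂(α.prod β)
      = 2 * dualValue ε α β (fun x => (u x + u' x) / 2) (fun y => (v y + v' y) / 2)
        - dualValue ε α β u v - dualValue ε α β u' v' := by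
  have hm := h.midpoint h'
  have hsq : ∀ z, (sqrtGibbs ε u v z - sqrtGibbs ε u' v' z) ^ 2
      = gibbsDensity ε u v z + gibbsDensity ε u' v' z
        - 2 * gibbsDensity ε (fun x => (u x + u' x) / 2) (fun y => (v y + v' y) / 2) z :=
    fun z => by rw [← sqrtGibbs_mul, ← sqrtGibbs_sq, ← sqrtGibbs_sq]; ring
  obtain ⟨K₁, hu⟩ := h.fst
  obtain ⟨K₂, hv⟩ := h.snd
  obtain ⟨K₃, hu'⟩ := h'.fst
  obtain ⟨K₄, hv'⟩ := h'.snd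
  have hadd : Integrable (fun z => gibbsDensity ε u v z + gibbsDensity ε u' v' z) (α.prod β) :=
    h.integrable.add h'.integrable
  simp only [hsq]
  refine ⟨hadd.sub (hm.integrable.const_mul 2), ?_⟩
  rw [integral_sub hadd (hm.integrable.const_mul 2), integral_add h.integrable h'.integrable,
    integral_const_mul]
  simp only [dualValue]
  rw [integral_div, integral_div, integral_add (hu.integrable hα) (hu'.integrable hα),
    integral_add (hv.integrable hβ) (hv'.integrable hβ)]
  ring

end DualValue

/-- The supremum of the dual objective over admissible pairs. -/
noncomputable def dualSup {d : ℕ} (ε : ℝ) (α β : Measure (Eucl d)) : ℝ :=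
  sSup {r | ∃ u v, IsAdmissible ε α β u v ∧ dualValue ε α β u v = r}

/-! ### Existence of product potentials -/

section Existence

variable {d : ℕ} {ε : ℝ} {α β : Measure (Eucl d)} [IsProbabilityMeasure α]
  [IsProbabilityMeasure β] {u v u' v' : Eucl d → ℝ}

theorem isTame_zero : IsTame (d := d) 0 fun _ => 0 := by
  refine ⟨measurable_const, fun x => by simp, fun x => ?_⟩
  rw [zero_mul, add_zero]; positivity

theorem dualValue_le_dualSup (hα : HasGaussianTail α) (hβ : HasGaussianTail β) (hε : 0 < ε)
    (h : IsAdmissible ε α β u v) : dualValue ε α β u v ≤ dualSup ε α β :=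
  le_csSup ⟨_, by rintro r ⟨u, v, h, rfl⟩; exact dualValue_le_cost hα hβ hε h⟩ ⟨u, v, h, rfl⟩

theorem integral_sqrtGibbs_sub_sq_le (hα : HasGaussianTail α) (hβ : HasGaussianTail β)
    (hε : 0 < ε) (h : IsAdmissible ε α β u v) (h' : IsAdmissible ε α β u' v') {δ : ℝ}
    (hδ : dualSup ε α β - δ ≤ dualValue ε α β u v)
    (hδ' : dualSup ε α β - δ ≤ dualValue ε α β u' v') :
    ∫ z, (sqrtGibbs ε u v z - sqrtGibbs ε u' v' z) ^ 2 ∂(α.prod β) ≤ 2 * δ / ε := by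
  have h1 := (integral_sqrtGibbs_sub_sq hα hβ h h').2
  have h2 := dualValue_le_dualSup hα hβ hε (h.midpoint h')
  rw [le_div_iff₀ hε, mul_comm]
  linarith

/-- Near-maximizers with growth bounds independent of the gap: starting from any near-maximizer,
normalize the means and take soft transforms twice. -/
theorem exists_tame_near_maximizer (hα : HasGaussianTail α) (hβ : HasGaussianTail β)
    (hε : 0 < ε) : ∃ K, ∀ δ, 0 < δ → δ ≤ 1 → ∃ v, IsTame K v ∧
      IsTame K (softTransform ε β v) ∧
      dualSup ε α β - δ ≤ dualValue ε α β (softTransform ε β v) v := by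
  set S := dualSup ε α β with hS
  -- a pair of equal means with value at least `S - 1` has means at least `-((1 - S) / 2)`
  obtain ⟨K₁, h₁⟩ := hα.softTransform_upper hε ((1 - S) / 2)
  obtain ⟨K₂, h₂⟩ := hβ.isTame_softTransform hε K₁ ((1 - S) / 2)
  obtain ⟨K₃, h₃⟩ := hα.isTame_softTransform hε K₂ ((1 - S) / 2)
  obtain ⟨K₄, h₄⟩ := hβ.isTame_softTransform hε K₃ ((1 - S) / 2)
  refine ⟨max K₃ K₄, fun δ hδ hδ1 => ?_⟩
  obtain ⟨_, ⟨u₀, v₀, hadm, rfl⟩, hlt⟩ := exists_lt_of_lt_csSup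
    (s := {r | ∃ u v, IsAdmissible ε α β u v ∧ dualValue ε α β u v = r})
    ⟨_, _, _, isAdmissible_softTransform hα hε isTame_zero, rfl⟩ (sub_lt_self S hδ)
  obtain ⟨L, hu₀⟩ := hadm.fst
  -- shift `u₀` so that it has the same mean as its soft transform
  obtain ⟨L₁, hT₀⟩ := exists_isTame_softTransform (ε := ε) hα hε hu₀
  obtain ⟨c, hc⟩ : ∃ c, c = (∫ y, softTransform ε α u₀ y ∂β - ∫ x, u₀ x ∂α) / 2 := ⟨_, rfl⟩
  have hu := hu₀.add_const c
  set u := fun x => u₀ x + c with hu_def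
  have hTu : softTransform ε α u = fun y => softTransform ε α u₀ y - c :=
    softTransform_add_const hε (hu₀.integrable_kernel hα hε) c
  have hmean : ∫ x, u x ∂α = ∫ y, softTransform ε α u y ∂β := by
    rw [hTu, hu_def, integral_add (hu₀.integrable hα) (integrable_const _),
      integral_sub (hT₀.integrable hβ) (integrable_const _)]
    simp only [integral_const, probReal_univ, smul_eq_mul, one_mul]
    rw [hc]; ring
  have hsum : ∫ x, u x ∂α + ∫ y, softTransform ε α u y ∂β
      = ∫ x, u₀ x ∂α + ∫ y, softTransform ε α u₀ y ∂β := by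
    rw [hTu, hu_def, integral_add (hu₀.integrable hα) (integrable_const _),
      integral_sub (hT₀.integrable hβ) (integrable_const _)]
    simp only [integral_const, probReal_univ, smul_eq_mul, one_mul]
    ring
  have hval := dualValue_le_softTransform hα hβ hε hadm
  rw [dualValue_softTransform hα hε hu₀, ← hsum] at hval
  obtain ⟨L₂, hv₁⟩ := exists_isTame_softTransform (ε := ε) hα hε hu
  -- `v₁ = Tu`, `u₁ = Tv₁`, `v₂ = Tu₁`, `u₂ = Tv₂`
  set v₁ := softTransform ε α u with hv₁_def
  have hu_mean : -((1 - S) / 2) ≤ ∫ x, u x ∂α := by linarith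
  have hv₁_upper := h₁ u (hu.integrable hα) (hu.integrable_kernel hα hε) hu_mean
  have hu₁ := h₂ v₁ hv₁.measurable (hv₁.integrable hβ) hv₁_upper (by linarith)
  have adm₁ : IsAdmissible ε α β u v₁ := isAdmissible_softTransform hα hε hu
  have hle₁ := dualValue_le_softTransform hβ hα hε adm₁.swap
  rw [dualValue_softTransform hβ hε hv₁, dualValue_swap, dualValue_softTransform hα hε hu] at hle₁
  set u₁ := softTransform ε β v₁ with hu₁_def
  have hv₂ := h₃ u₁ hu₁.measurable (hu₁.integrable hα) hu₁.upper (by linarith)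
  have adm₂ : IsAdmissible ε β α v₁ u₁ := isAdmissible_softTransform hβ hε hv₁
  have hle₂ := dualValue_le_softTransform hα hβ hε adm₂.swap
  rw [dualValue_softTransform hα hε hu₁, dualValue_swap, dualValue_softTransform hβ hε hv₁]
    at hle₂
  set v₂ := softTransform ε α u₁ with hv₂_def
  have hu₂ := h₄ v₂ hv₂.measurable (hv₂.integrable hβ) hv₂.upper (by linarith)
  have adm₃ : IsAdmissible ε α β u₁ v₂ := isAdmissible_softTransform hα hε hu₁
  have hle₃ := dualValue_le_softTransform hβ hα hε adm₃.swap
  rw [dualValue_swap, dualValue_softTransform hα hε hu₁] at hle₃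
  refine ⟨v₂, hv₂.mono (le_max_left _ _), hu₂.mono (le_max_right _ _), ?_⟩
  rw [← dualValue_swap]
  linarith

end Existence

section FixedPoint

variable {d : ℕ} {ε : ℝ} {α β : Measure (Eucl d)}

theorem eLpNorm_two_lt_of_integral_sq_lt {X : Type*} [MeasurableSpace X] {ρ : Measure X}
    {f : X → ℝ} (hf : AEStronglyMeasurable f ρ) (hI : Integrable (fun x => f x ^ 2) ρ) {r : ℝ}
    (hr : 0 < r) (h : ∫ x, f x ^ 2 ∂ρ < r ^ 2) : eLpNorm f 2 ρ < ENNReal.ofReal r := by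
  rw [MemLp.eLpNorm_eq_integral_rpow_norm (by norm_num) (by norm_num)
    ((memLp_two_iff_integrable_sq hf).2 hI), ENNReal.ofReal_lt_ofReal_iff hr]
  have h0 : 0 ≤ ∫ x, f x ^ 2 ∂ρ := integral_nonneg fun _ => sq_nonneg _
  simp only [ENNReal.toReal_ofNat, Real.rpow_two, Real.norm_eq_abs, sq_abs]
  rw [← one_div, ← Real.sqrt_eq_rpow, Real.sqrt_lt' hr]
  exact h

/-- If the gaps to the supremum decay geometrically, the square roots of the Gibbs densities are
Cauchy in `L²` with a summable modulus, hence converge almost everywhere. On almost every slice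
`x = x₀` this is the convergence of the second potential, normalized at `x₀`. -/
theorem exists_ae_tendsto_normalized [IsProbabilityMeasure α] [IsProbabilityMeasure β]
    (hα : HasGaussianTail α) (hβ : HasGaussianTail β) (hε : 0 < ε) {K : ℝ}
    {u v : ℕ → Eucl d → ℝ} (hu : ∀ n, IsTame K (u n)) (hv : ∀ n, IsTame K (v n))
    (hadm : ∀ n, IsAdmissible ε α β (u n) (v n))
    (hval : ∀ n, dualSup ε α β - ε / 4 * (1 / 4) ^ n ≤ dualValue ε α β (u n) (v n)) :
    ∃ x₀, ∃ w : Eucl d → ℝ, Measurable w ∧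
      ∀ᵐ y ∂β, Tendsto (fun n => v n y + u n x₀) atTop (𝓝 (w y)) := by
  have hmeas : ∀ n, Measurable (sqrtGibbs ε (u n) (v n)) := fun n =>
    measurable_sqrtGibbs (hu n).measurable (hv n).measurable
  have hgap : ∀ {N n}, N ≤ n →
      dualSup ε α β - ε / 4 * (1 / 4) ^ N ≤ dualValue ε α β (u n) (v n) := fun {N n} h => by
    refine le_trans ?_ (hval n)
    have : ((1 : ℝ) / 4) ^ n ≤ (1 / 4) ^ N :=
      pow_le_pow_of_le_one (by norm_num) (by norm_num) h
    have := mul_le_mul_of_nonneg_left this (by positivity : 0 ≤ ε / 4)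
    linarith
  have hsum : ∑' i : ℕ, ENNReal.ofReal ((1 / 2) ^ i) ≠ ∞ := by
    rw [← ENNReal.ofReal_tsum_of_nonneg (fun _ => by positivity) summable_geometric_two]
    exact ENNReal.ofReal_ne_top
  have hcau : ∀ N n m : ℕ, N ≤ n → N ≤ m →
      eLpNorm (sqrtGibbs ε (u n) (v n) - sqrtGibbs ε (u m) (v m)) 2 (α.prod β)
        < ENNReal.ofReal ((1 / 2) ^ N) := fun N n m hn hm => by
    refine eLpNorm_two_lt_of_integral_sq_lt ((hmeas n).sub (hmeas m)).aestronglyMeasurable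
      (integral_sqrtGibbs_sub_sq hα hβ (hadm n) (hadm m)).1 (by positivity) ?_
    refine lt_of_le_of_lt (integral_sqrtGibbs_sub_sq_le hα hβ hε (hadm n) (hadm m)
      (hgap hn) (hgap hm)) ?_
    have h4 : (((1 : ℝ) / 2) ^ N) ^ 2 = (1 / 4) ^ N := by
      rw [← pow_mul, mul_comm, pow_mul]; norm_num
    have h5 : (0 : ℝ) < (1 / 4) ^ N := by positivity
    have h6 : 2 * (ε / 4 * (1 / 4) ^ N) / ε = (1 / 4 : ℝ) ^ N / 2 := by field_simp; ring
    rw [h6, h4]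
    linarith
  have hae := Lp.ae_tendsto_of_cauchy_eLpNorm (fun n => (hmeas n).aestronglyMeasurable)
    (by norm_num : (1 : ℝ≥0∞) ≤ 2) hsum hcau
  obtain ⟨x₀, hx₀⟩ := (Measure.ae_ae_of_ae_prod hae).exists
  refine ⟨x₀, measurable_limit_of_tendsto_metrizable_ae
    (fun n => ((hv n).measurable.add_const _).aemeasurable) ?_⟩
  filter_upwards [hx₀] with y hy
  obtain ⟨l, hl⟩ := hy
  -- the uniform lower bound of the potentials keeps the limit away from zero
  have hlow : ∀ n, Real.exp ((-(K * (1 + ‖x₀‖ ^ 2)) + -(K * (1 + ‖y‖ ^ 2)) - ‖x₀ - y‖ ^ 2)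
      / (2 * ε)) ≤ sqrtGibbs ε (u n) (v n) (x₀, y) := fun n => by
    refine Real.exp_le_exp.2 (div_le_div_of_nonneg_right ?_ (by positivity))
    have h1 := (hu n).lower x₀
    have h2 := (hv n).lower y
    simp only
    linarith
  have hlpos : 0 < l := lt_of_lt_of_le (Real.exp_pos _) (ge_of_tendsto' hl hlow)
  refine ⟨2 * ε * Real.log l + ‖x₀ - y‖ ^ 2, ?_⟩
  refine (((hl.log hlpos.ne').const_mul (2 * ε)).add_const _).congr fun n => ?_
  rw [sqrtGibbs, Real.log_exp]
  field_simp; ring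

/-- Existence of a pair of tame functions that are soft transforms of each other. -/
theorem exists_softTransform_fixedPoint [IsProbabilityMeasure α] [IsProbabilityMeasure β]
    (hα : HasGaussianTail α) (hβ : HasGaussianTail β) (hε : 0 < ε) :
    ∃ K, ∃ φ ψ : Eucl d → ℝ, IsTame K φ ∧ IsTame K ψ ∧
      φ = softTransform ε β ψ ∧ ψ = softTransform ε α φ := by
  obtain ⟨K, hK⟩ := exists_tame_near_maximizer hα hβ hε
  have hδ : ∀ n : ℕ, 0 < min 1 (ε / 4) * (1 / 4) ^ n := fun n => by positivity
  have hpow : ∀ n : ℕ, ((1 : ℝ) / 4) ^ n ≤ 1 := fun n => pow_le_one₀ (by norm_num) (by norm_num)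
  have hδ1 : ∀ n : ℕ, min 1 (ε / 4) * (1 / 4) ^ n ≤ 1 := fun n =>
    mul_le_one₀ (min_le_left _ _) (by positivity) (hpow n)
  choose v hv hu hval using fun n => hK _ (hδ n) (hδ1 n)
  have hadm : ∀ n, IsAdmissible ε α β (softTransform ε β (v n)) (v n) := fun n =>
    (isAdmissible_softTransform hβ hε (hv n)).swap
  have hval' : ∀ n, dualSup ε α β - ε / 4 * (1 / 4) ^ n
      ≤ dualValue ε α β (softTransform ε β (v n)) (v n) := fun n => by
    have := mul_le_mul_of_nonneg_right (min_le_right 1 (ε / 4))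
      (by positivity : (0 : ℝ) ≤ (1 / 4) ^ n)
    linarith [hval n]
  obtain ⟨x₀, w, hw, hlim⟩ := exists_ae_tendsto_normalized hα hβ hε hu hv hadm hval'
  -- normalized potentials: `v n + c n` and its soft transform `Tβ (v n) - c n`
  set c : ℕ → ℝ := fun n => softTransform ε β (v n) x₀ with hc
  set L := (1 + 2 * K) * (1 + ‖x₀‖ ^ 2) with hL
  have hcL : ∀ n, |c n| ≤ L := fun n => (hu n).abs_le_mul x₀
  set v' : ℕ → Eucl d → ℝ := fun n y => v n y + c n with hv'_def
  have hv' : ∀ n, IsTame (K + L) (v' n) := fun n =>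
    ((hv n).add_const (c n)).mono (by linarith [hcL n])
  set u' : ℕ → Eucl d → ℝ := fun n => softTransform ε β (v' n) with hu'_def
  have hu'_eq : ∀ n, u' n = fun x => softTransform ε β (v n) x + -c n := fun n =>
    softTransform_add_const hε ((hv n).integrable_kernel hβ hε) (c n)
  have hu' : ∀ n, IsTame (K + L) (u' n) := fun n => by
    rw [hu'_eq]
    exact ((hu n).add_const (-c n)).mono (by rw [abs_neg]; linarith [hcL n])
  obtain ⟨φ, hφ_def⟩ : ∃ φ, φ = softTransform ε β w := ⟨_, rfl⟩
  have hφlim : ∀ x, Tendsto (fun n => u' n x) atTop (𝓝 (φ x)) := by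
    rw [hφ_def]
    exact tendsto_softTransform hβ hε (fun n => (hv' n).measurable) hw
      (fun n => (hv' n).upper) hlim
  have hφ : IsTame (K + L) φ := by
    refine ⟨hφ_def ▸ measurable_softTransform hw, fun x => ?_, fun x => ?_⟩
    · exact ge_of_tendsto' (hφlim x) fun n => (hu' n).lower x
    · exact le_of_tendsto' (hφlim x) fun n => (hu' n).upper x
  have hψlim : ∀ y, Tendsto (fun n => softTransform ε α (u' n) y) atTop
      (𝓝 (softTransform ε α φ y)) :=
    tendsto_softTransform hα hε (fun n => (hu' n).measurable) hφ.measurable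
      (fun n => (hu' n).upper) (Eventually.of_forall hφlim)
  -- uniform bounds, for passage to the limit in the values
  obtain ⟨M, hM⟩ : ∃ M, ∀ n, -M ≤ ∫ x, u' n x ∂α := by
    refine ⟨∫ x, (1 + 2 * (K + L)) * (1 + ‖x‖ ^ 2) ∂α, fun n => ?_⟩
    rw [← integral_neg]
    exact integral_mono (hα.integrable_one_add_sq _).neg ((hu' n).integrable hα)
      fun x => (abs_le.1 ((hu' n).abs_le_mul x)).1
  obtain ⟨K', hK'⟩ := hα.isTame_softTransform hε (K + L) M
  have hT : ∀ n, IsTame K' (softTransform ε α (u' n)) := fun n =>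
    hK' _ (hu' n).measurable ((hu' n).integrable hα) (hu' n).upper (hM n)
  have hlim₁ : Tendsto (fun n => ∫ x, u' n x ∂α) atTop (𝓝 (∫ x, φ x ∂α)) :=
    tendsto_integral_of_dominated_convergence _
      (fun n => (hu' n).measurable.aestronglyMeasurable)
      (hα.integrable_one_add_sq (1 + 2 * (K + L)))
      (fun n => Eventually.of_forall fun x => (hu' n).abs_le_mul x) (Eventually.of_forall hφlim)
  have hlim₂ : Tendsto (fun n => ∫ y, softTransform ε α (u' n) y ∂β) atTop
      (𝓝 (∫ y, softTransform ε α φ y ∂β)) :=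
    tendsto_integral_of_dominated_convergence _
      (fun n => (hT n).measurable.aestronglyMeasurable)
      (hβ.integrable_one_add_sq (1 + 2 * K'))
      (fun n => Eventually.of_forall fun x => (hT n).abs_le_mul x) (Eventually.of_forall hψlim)
  have hvaln : ∀ n, dualSup ε α β - ε / 4 * (1 / 4) ^ n
      ≤ ∫ x, u' n x ∂α + ∫ y, softTransform ε α (u' n) y ∂β := fun n => by
    have hadm' : IsAdmissible ε α β (u' n) (v' n) :=
      (isAdmissible_softTransform hβ hε (hv' n)).swap
    have h1 := dualValue_le_softTransform hα hβ hε hadm'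
    rw [dualValue_softTransform hα hε (hu' n), ← dualValue_swap,
      dualValue_softTransform hβ hε (hv' n)] at h1
    have h2 := hval' n
    rw [← dualValue_swap, dualValue_softTransform hβ hε (hv n)] at h2
    have h3 : ∫ y, v' n y ∂β + ∫ x, u' n x ∂α
        = ∫ y, v n y ∂β + ∫ x, softTransform ε β (v n) x ∂α := by
      rw [hu'_eq, hv'_def, integral_add ((hv n).integrable hβ) (integrable_const _),
        integral_add ((hu n).integrable hα) (integrable_const _)]
      simp only [integral_const, probReal_univ, smul_eq_mul, one_mul]
      ring
    change ∫ y, v' n y ∂β + ∫ x, u' n x ∂α ≤ _ at h1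
    linarith
  set ψ := softTransform ε α φ with hψ_def
  have hmax : dualSup ε α β ≤ ∫ x, φ x ∂α + ∫ y, ψ y ∂β := by
    have hgeo : Tendsto (fun n : ℕ => dualSup ε α β - ε / 4 * (1 / 4) ^ n) atTop
        (𝓝 (dualSup ε α β - ε / 4 * 0)) :=
      ((tendsto_pow_atTop_nhds_zero_of_lt_one (by norm_num) (by norm_num)).const_mul _).const_sub _
    rw [mul_zero, sub_zero] at hgeo
    exact le_of_tendsto_of_tendsto' hgeo (hlim₁.add hlim₂) hvaln
  -- `(φ, ψ)` and `(Tβ ψ, ψ)` are both maximal, hence `φ = Tβ ψ` almost everywhere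
  have hφψ : IsAdmissible ε α β φ ψ := isAdmissible_softTransform hα hε hφ
  obtain ⟨Kψ, hψ⟩ := hφψ.snd
  obtain ⟨Kφ', hφ'⟩ := exists_isTame_softTransform (ε := ε) hβ hε hψ
  have hadm₂ : IsAdmissible ε α β (softTransform ε β ψ) ψ :=
    (isAdmissible_softTransform hβ hε hψ).swap
  have hmax₁ : dualSup ε α β ≤ dualValue ε α β φ ψ := by
    rw [hψ_def, dualValue_softTransform hα hε hφ]; exact hmax
  have hmax₂ : dualSup ε α β ≤ dualValue ε α β (softTransform ε β ψ) ψ := by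
    refine hmax₁.trans ?_
    have := dualValue_le_softTransform hβ hα hε hφψ.swap
    rwa [dualValue_swap (α := α) (β := β), dualValue_swap (α := α) (β := β)] at this
  have hzero : ∫ z, (sqrtGibbs ε φ ψ z - sqrtGibbs ε (softTransform ε β ψ) ψ z) ^ 2 ∂(α.prod β)
      = 0 := by
    refine le_antisymm ?_ (integral_nonneg fun _ => sq_nonneg _)
    have := integral_sqrtGibbs_sub_sq_le hα hβ hε hφψ hadm₂ (δ := 0) (by linarith) (by linarith)
    simpa using this
  rw [integral_eq_zero_iff_of_nonneg (fun _ => sq_nonneg _)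
    (integral_sqrtGibbs_sub_sq hα hβ hφψ hadm₂).1] at hzero
  have hae : φ =ᵐ[α] softTransform ε β ψ := by
    filter_upwards [Measure.ae_ae_of_ae_prod hzero] with x hx
    obtain ⟨y, hy⟩ := hx.exists
    have h1 := sub_eq_zero.1 (pow_eq_zero_iff two_ne_zero |>.1 hy)
    simp only [sqrtGibbs] at h1
    have h2 := Real.exp_injective h1
    rw [div_left_inj' (by positivity)] at h2
    linarith
  have hfix : ψ = softTransform ε α (softTransform ε β ψ) := by
    rw [hψ_def]; exact softTransform_congr hae
  exact ⟨max Kφ' Kψ, softTransform ε β ψ, ψ, hφ'.mono (le_max_left _ _),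
    hψ.mono (le_max_right _ _), rfl, hfix⟩

end FixedPoint

/-! ### The Sinkhorn equations -/

section Sinkhorn

variable {d : ℕ} {ε : ℝ}

/-- Up to the factor `exp (-‖y‖² / ε)`, the integral in the soft transform is a Laplace transform in
`y`: it is convex, hence continuous where it is finite everywhere. -/
theorem continuous_softTransform {μ : Measure (Eucl d)} [NeZero μ] {u : Eucl d → ℝ}
    (h : ∀ y, Integrable (fun x => Real.exp ((u x - ‖x - y‖ ^ 2) / ε)) μ) :
    Continuous (softTransform ε μ u) := by
  set G : Eucl d → ℝ := fun y => ∫ x, Real.exp ((u x - ‖x‖ ^ 2 + 2 * inner ℝ x y) / ε) ∂μ with hG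
  have hfac : ∀ x y, Real.exp ((u x - ‖x - y‖ ^ 2) / ε)
      = Real.exp (-‖y‖ ^ 2 / ε) * Real.exp ((u x - ‖x‖ ^ 2 + 2 * inner ℝ x y) / ε) :=
    fun x y => by rw [← Real.exp_add, norm_sub_sq_real]; congr 1; ring
  have hfac' : ∀ x y, Real.exp ((u x - ‖x‖ ^ 2 + 2 * inner ℝ x y) / ε)
      = Real.exp (‖y‖ ^ 2 / ε) * Real.exp ((u x - ‖x - y‖ ^ 2) / ε) :=
    fun x y => by rw [← Real.exp_add, norm_sub_sq_real]; congr 1; ring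
  have hGint : ∀ y, Integrable (fun x => Real.exp ((u x - ‖x‖ ^ 2 + 2 * inner ℝ x y) / ε)) μ :=
    fun y => by simp only [hfac']; exact (h y).const_mul _
  have hconv : ConvexOn ℝ Set.univ G := by
    refine ⟨convex_univ, fun y _ z _ s t hs ht hst => ?_⟩
    simp only [hG, smul_eq_mul]
    rw [← integral_const_mul, ← integral_const_mul,
      ← integral_add ((hGint y).const_mul s) ((hGint z).const_mul t)]
    refine integral_mono (hGint _) (((hGint y).const_mul s).add ((hGint z).const_mul t))
      fun x => ?_
    have h1 := convexOn_exp.2 (Set.mem_univ ((u x - ‖x‖ ^ 2 + 2 * inner ℝ x y) / ε))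
      (Set.mem_univ ((u x - ‖x‖ ^ 2 + 2 * inner ℝ x z) / ε)) hs ht hst
    simp only [smul_eq_mul] at h1
    refine le_trans (le_of_eq ?_) h1
    obtain rfl : s = 1 - t := by linarith
    simp only [inner_add_right, inner_smul_right]
    congr 1; ring
  have hGcont : Continuous G := hconv.locallyLipschitz.continuous
  have heq : softTransform ε μ u = fun y => -ε * (-‖y‖ ^ 2 / ε + Real.log (G y)) := by
    funext y
    simp only [softTransform, hfac]
    rw [integral_const_mul, Real.log_mul (Real.exp_pos _).ne' (integral_exp_pos (hGint y)).ne',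
      Real.log_exp]
  rw [heq]
  exact ((by fun_prop : Continuous fun y : Eucl d => -‖y‖ ^ 2 / ε).add
    (hGcont.log fun y => (integral_exp_pos (hGint y)).ne')).const_mul (-ε)

variable {α β : Measure (Eucl d)} {φ ψ : Eucl d → ℝ}

theorem IsProductSinkhorn.swap (h : IsProductSinkhorn ε α β φ ψ) :
    IsProductSinkhorn ε β α ψ φ where
  integrable_fst := h.integrable_snd
  integrable_snd := h.integrable_fst
  eq_fst y := by simpa only [norm_sub_rev y] using h.eq_snd y
  eq_snd x := by simpa only [norm_sub_rev _ x] using h.eq_fst x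

theorem IsProductSinkhorn.integrable_kernel (h : IsProductSinkhorn ε α β φ ψ) (y : Eucl d) :
    Integrable (fun x => Real.exp ((φ x - ‖x - y‖ ^ 2) / ε)) α := by
  by_contra hn
  have := h.eq_snd y
  rw [integral_undef hn, mul_zero] at this
  exact zero_ne_one this

theorem IsProductSinkhorn.eq_softTransform [NeZero α] (hε : 0 < ε)
    (h : IsProductSinkhorn ε α β φ ψ) : ψ = softTransform ε α φ := by
  funext y
  have h1 := congrArg Real.log (h.eq_snd y)
  rw [Real.log_mul (Real.exp_pos _).ne' (integral_exp_pos (h.integrable_kernel y)).ne',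
    Real.log_exp, Real.log_one] at h1
  rw [softTransform]
  field_simp at h1
  linarith

theorem isProductSinkhorn_of_softTransform [NeZero α] [NeZero β] (hε : 0 < ε)
    (hφ : Integrable φ α) (hψ : Integrable ψ β)
    (hα : ∀ y, Integrable (fun x => Real.exp ((φ x - ‖x - y‖ ^ 2) / ε)) α)
    (hβ : ∀ x, Integrable (fun y => Real.exp ((ψ y - ‖y - x‖ ^ 2) / ε)) β)
    (h₁ : φ = softTransform ε β ψ) (h₂ : ψ = softTransform ε α φ) :
    IsProductSinkhorn ε α β φ ψ where
  integrable_fst := hφ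
  integrable_snd := hψ
  eq_fst x := by
    rw [show φ x = softTransform ε β ψ x from congrFun h₁ x]
    simpa only [norm_sub_rev x] using exp_softTransform hε (hβ x)
  eq_snd y := by
    rw [show ψ y = softTransform ε α φ y from congrFun h₂ y]
    exact exp_softTransform hε (hα y)

theorem IsProductSinkhorn.continuous_snd [NeZero α] (hε : 0 < ε)
    (h : IsProductSinkhorn ε α β φ ψ) : Continuous ψ := by
  rw [h.eq_softTransform hε]
  exact continuous_softTransform h.integrable_kernel

theorem IsProductSinkhorn.exists_isTame [IsProbabilityMeasure α] [IsProbabilityMeasure β]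
    (hα : HasGaussianTail α) (hβ : HasGaussianTail β) (hε : 0 < ε)
    (h : IsProductSinkhorn ε α β φ ψ) : ∃ K, IsTame K φ := by
  obtain ⟨K₁, h₁⟩ := hα.softTransform_upper hε (-∫ x, φ x ∂α)
  have hψ := h₁ φ h.integrable_fst h.integrable_kernel (by simp)
  rw [← h.eq_softTransform hε] at hψ
  obtain ⟨K₂, h₂⟩ := hβ.isTame_softTransform hε K₁ (-∫ y, ψ y ∂β)
  refine ⟨K₂, ?_⟩
  rw [h.swap.eq_softTransform hε]
  exact h₂ ψ (h.continuous_snd hε).measurable h.integrable_snd hψ (by simp)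

/-! ### Marginals of Gibbs plans -/

variable {m₁ m₂ : Measure (Eucl d)} {f g a b : Eucl d → ℝ}

theorem lintegral_gibbsDensity_right (ha : ∀ x, 0 < a x)
    (h : ∀ x, Real.exp (f x / ε) * ∫ y, Real.exp ((g y - ‖x - y‖ ^ 2) / ε) ∂m₂ = a x)
    (x : Eucl d) : ∫⁻ y, ENNReal.ofReal (gibbsDensity ε f g (x, y)) ∂m₂
      = ENNReal.ofReal (a x) := by
  have hI : Integrable (fun y => Real.exp ((g y - ‖x - y‖ ^ 2) / ε)) m₂ := by
    by_contra hn
    have := h x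
    rw [integral_undef hn, mul_zero] at this
    exact (ha x).ne this
  have heq : ∀ y, gibbsDensity ε f g (x, y)
      = Real.exp (f x / ε) * Real.exp ((g y - ‖x - y‖ ^ 2) / ε) := fun y => by
    rw [gibbsDensity, ← Real.exp_add]
    congr 1; ring
  simp only [heq]
  rw [← ofReal_integral_eq_lintegral_ofReal (hI.const_mul _)
    (Eventually.of_forall fun _ => by positivity), integral_const_mul, h x]

variable [SFinite m₁] [SFinite m₂]

theorem fst_gibbsPlan (hf : Measurable f) (hg : Measurable g) (ha : ∀ x, 0 < a x)
    (h : ∀ x, Real.exp (f x / ε) * ∫ y, Real.exp ((g y - ‖x - y‖ ^ 2) / ε) ∂m₂ = a x) :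
    (gibbsPlan ε m₁ m₂ f g).fst = m₁.withDensity fun x => ENNReal.ofReal (a x) := by
  ext s hs
  rw [Measure.fst_apply hs, gibbsPlan, withDensity_apply _ (measurable_fst hs),
    withDensity_apply _ hs, ← Set.prod_univ, ← Measure.prod_restrict, Measure.restrict_univ,
    lintegral_prod _ (measurable_gibbsDensity hf hg).ennreal_ofReal.aemeasurable]
  simp only [lintegral_gibbsDensity_right ha h]

theorem snd_gibbsPlan (hf : Measurable f) (hg : Measurable g) (hb : ∀ y, 0 < b y)
    (h : ∀ y, Real.exp (g y / ε) * ∫ x, Real.exp ((f x - ‖x - y‖ ^ 2) / ε) ∂m₁ = b y) :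
    (gibbsPlan ε m₁ m₂ f g).snd = m₂.withDensity fun y => ENNReal.ofReal (b y) := by
  have h' : ∀ y, Real.exp (g y / ε) * ∫ x, Real.exp ((f x - ‖y - x‖ ^ 2) / ε) ∂m₁ = b y :=
    fun y => by simpa only [norm_sub_rev y] using h y
  ext s hs
  rw [Measure.snd_apply hs, gibbsPlan, withDensity_apply _ (measurable_snd hs),
    withDensity_apply _ hs, ← Set.univ_prod, ← Measure.prod_restrict, Measure.restrict_univ,
    lintegral_prod_symm _ (measurable_gibbsDensity hf hg).ennreal_ofReal.aemeasurable]
  refine lintegral_congr fun y => ?_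
  rw [← lintegral_gibbsDensity_right hb h' y]
  refine lintegral_congr fun x => ?_
  rw [← gibbsDensity_swap, Prod.swap_prod_mk]

theorem IsProductSinkhorn.isTransportPlan [IsProbabilityMeasure α] [IsProbabilityMeasure β]
    (hε : 0 < ε) (h : IsProductSinkhorn ε α β φ ψ) :
    IsTransportPlan α β (gibbsPlan ε α β φ ψ) := by
  have hφ := (h.swap.continuous_snd hε).measurable
  have hψ := (h.continuous_snd hε).measurable
  constructor
  · rw [fst_gibbsPlan hφ hψ (fun _ => one_pos) h.eq_fst]
    simp
  · rw [snd_gibbsPlan hφ hψ (fun _ => one_pos) h.eq_snd]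
    simp

/-! ### Change of the reference measure -/

/-- The log-likelihood ratio with respect to Lebesgue measure is the logarithm of the density. -/
theorem llr_withDensity_ae_eq {a : Eucl d → ℝ} (ha : Measurable a) (ha_pos : ∀ x, 0 < a x)
    (hα : α = volume.withDensity fun x => ENNReal.ofReal (a x)) :
    llr α volume =ᵐ[volume] fun x => Real.log (a x) := by
  subst hα
  filter_upwards [Measure.rnDeriv_withDensity volume ha.ennreal_ofReal] with x hx
  rw [llr, hx, ENNReal.toReal_ofReal (ha_pos x).le]

theorem integrable_log_density {a : Eucl d → ℝ} (ha : Measurable a) (ha_pos : ∀ x, 0 < a x)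
    (hα : α = volume.withDensity fun x => ENNReal.ofReal (a x))
    (hE : relEntropy α volume ≠ ⊤) : Integrable (fun x => Real.log (a x)) α := by
  have h : α ≪ volume ∧ Integrable (llr α volume) α := by
    by_contra hn
    exact hE (if_neg hn)
  exact h.2.congr (h.1.ae_le (llr_withDensity_ae_eq ha ha_pos hα))

theorem integral_exp_add_log {b : Eucl d → ℝ} (hε : 0 < ε) (hb : Measurable b)
    (hb_pos : ∀ x, 0 < b x)
    (hβ : β = volume.withDensity fun x => ENNReal.ofReal (b x)) (x : Eucl d) :
    ∫ y, Real.exp ((ψ y + ε * Real.log (b y) - ‖x - y‖ ^ 2) / ε)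
      = ∫ y, Real.exp ((ψ y - ‖x - y‖ ^ 2) / ε) ∂β := by
  rw [hβ, integral_withDensity_eq_integral_toReal_smul hb.ennreal_ofReal
    (Eventually.of_forall fun _ => ENNReal.ofReal_lt_top)]
  refine integral_congr_ae (Eventually.of_forall fun y => ?_)
  simp only [ENNReal.toReal_ofReal (hb_pos y).le, smul_eq_mul]
  rw [← Real.exp_log (hb_pos y), ← Real.exp_add, Real.exp_log (hb_pos y)]
  congr 1; field_simp; ring

theorem isProductSinkhorn_iff_isLebesgueSinkhorn {a b : Eucl d → ℝ} (hε : 0 < ε)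
    (ha : Measurable a) (hb : Measurable b) (ha_pos : ∀ x, 0 < a x) (hb_pos : ∀ x, 0 < b x)
    (hα : α = volume.withDensity fun x => ENNReal.ofReal (a x))
    (hβ : β = volume.withDensity fun x => ENNReal.ofReal (b x))
    (hαE : relEntropy α volume ≠ ⊤) (hβE : relEntropy β volume ≠ ⊤) :
    IsProductSinkhorn ε α β φ ψ ↔
      IsLebesgueSinkhorn ε α β a b
        (fun x => φ x + ε * Real.log (a x)) (fun y => ψ y + ε * Real.log (b y)) := by
  have hla := (integrable_log_density ha ha_pos hα hαE).const_mul ε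
  have hlb := (integrable_log_density hb hb_pos hβ hβE).const_mul ε
  have hexp : ∀ {c r : ℝ}, 0 < c → Real.exp ((r + ε * Real.log c) / ε) = Real.exp (r / ε) * c :=
    fun {c r} hc => by
      rw [add_div, mul_div_cancel_left₀ _ hε.ne', Real.exp_add, Real.exp_log hc]
  have heq : ∀ {c p q : ℝ}, 0 < c → (p * q = 1 ↔ p * c * q = c) := fun {c p q} hc => by
    rw [mul_right_comm, mul_eq_right₀ hc.ne']
  have key₁ : ∀ x, (Real.exp (φ x / ε) * ∫ y, Real.exp ((ψ y - ‖x - y‖ ^ 2) / ε) ∂β = 1 ↔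
      Real.exp ((φ x + ε * Real.log (a x)) / ε)
        * ∫ y, Real.exp ((ψ y + ε * Real.log (b y) - ‖x - y‖ ^ 2) / ε) = a x) := fun x => by
    rw [integral_exp_add_log hε hb hb_pos hβ, hexp (ha_pos x)]
    exact heq (ha_pos x)
  have key₂ : ∀ y, (Real.exp (ψ y / ε) * ∫ x, Real.exp ((φ x - ‖x - y‖ ^ 2) / ε) ∂α = 1 ↔
      Real.exp ((ψ y + ε * Real.log (b y)) / ε)
        * ∫ x, Real.exp ((φ x + ε * Real.log (a x) - ‖x - y‖ ^ 2) / ε) = b y) := fun y => by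
    simp only [norm_sub_rev _ y]
    rw [integral_exp_add_log hε ha ha_pos hα, hexp (hb_pos y)]
    exact heq (hb_pos y)
  constructor
  · intro h
    exact ⟨h.integrable_fst.add hla, h.integrable_snd.add hlb, fun x => (key₁ x).1 (h.eq_fst x),
      fun y => (key₂ y).1 (h.eq_snd y)⟩
  · intro h
    refine ⟨(integrable_add_iff_integrable_left' hla).1 h.integrable_fst,
      (integrable_add_iff_integrable_left' hlb).1 h.integrable_snd,
      fun x => (key₁ x).2 (h.eq_fst x), fun y => (key₂ y).2 (h.eq_snd y)⟩

theorem IsLebesgueSinkhorn.isTransportPlan {a b : Eucl d → ℝ} (hf : Measurable f)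
    (hg : Measurable g) (ha_pos : ∀ x, 0 < a x) (hb_pos : ∀ x, 0 < b x)
    (hα : α = volume.withDensity fun x => ENNReal.ofReal (a x))
    (hβ : β = volume.withDensity fun x => ENNReal.ofReal (b x))
    (h : IsLebesgueSinkhorn ε α β a b f g) :
    IsTransportPlan α β (gibbsPlan ε volume volume f g) := by
  constructor
  · rw [fst_gibbsPlan hf hg ha_pos h.eq_fst, hα]
  · rw [snd_gibbsPlan hf hg hb_pos h.eq_snd, hβ]

end Sinkhorn

/-! ### The directional derivative of the entropy -/

section EntropyDerivative

theorem mul_log_tangent_le {p q : ℝ} (hp : 0 < p) (hq : 0 ≤ q) :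
    p * Real.log p + (Real.log p + 1) * (q - p) ≤ q * Real.log q := by
  rcases hq.eq_or_lt with rfl | hq
  · simp only [zero_mul]
    linarith
  · have h1 := Real.log_le_sub_one_of_pos (div_pos hp hq)
    rw [Real.log_div hp.ne' hq.ne'] at h1
    have h2 := mul_le_mul_of_nonneg_left h1 hq.le
    rw [mul_sub q (p / q), mul_div_cancel₀ _ hq.ne'] at h2
    linarith

theorem mix_mul_log_le {p n r : ℝ} (hp : 0 ≤ p) (hn : 0 ≤ n) (h0 : 0 ≤ r) (h1 : r ≤ 1) :
    ((1 - r) * p + r * n) * Real.log ((1 - r) * p + r * n)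
      ≤ (1 - r) * (p * Real.log p) + r * (n * Real.log n) :=
  Real.convexOn_mul_log.2 hp hn (by linarith) h0 (by ring)

theorem tendsto_mix_mul_log {p : ℝ} (hp : 0 < p) (n : ℝ) :
    Tendsto (fun r : ℝ => (((1 - r) * p + r * n) * Real.log ((1 - r) * p + r * n)
      - p * Real.log p) / r) (𝓝[>] 0) (𝓝 ((Real.log p + 1) * (n - p))) := by
  have h1 : HasDerivAt (fun r : ℝ => (1 - r) * p + r * n) (n - p) 0 := by
    have h := (((hasDerivAt_id (0 : ℝ)).const_sub 1).mul_const p).add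
      ((hasDerivAt_id (0 : ℝ)).mul_const n)
    exact h.congr_deriv (by ring)
  have h2 : HasDerivAt (fun x => x * Real.log x) (Real.log p + 1) ((1 - 0) * p + 0 * n) := by
    have : (1 - 0) * p + 0 * n = p := by ring
    rw [this]
    exact Real.hasDerivAt_mul_log hp.ne'
  have h3 := (HasDerivAt.comp (0 : ℝ) h2 h1).tendsto_slope_zero_right
  refine h3.congr fun r => ?_
  simp only [Function.comp, zero_add, smul_eq_mul]
  rw [show (1 - 0) * p + 0 * n = p by ring, div_eq_inv_mul]

variable {X : Type*} [MeasurableSpace X] {ρ : Measure X} {p n : X → ℝ}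

/-- On the segment from `p` to `n` the entropy integrand lies between its tangent and its chord. -/
theorem integrable_mix_mul_log (hpm : Measurable p) (hnm : Measurable n) (hp : ∀ x, 0 < p x)
    (hn : ∀ x, 0 ≤ n x) (hpi : Integrable p ρ) (hni : Integrable n ρ)
    (hpp : Integrable (fun x => p x * Real.log (p x)) ρ)
    (hnn : Integrable (fun x => n x * Real.log (n x)) ρ)
    (hnp : Integrable (fun x => n x * Real.log (p x)) ρ) {r : ℝ} (h0 : 0 ≤ r) (h1 : r ≤ 1) :
    Integrable (fun x => ((1 - r) * p x + r * n x) * Real.log ((1 - r) * p x + r * n x)) ρ := by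
  have hlow : Integrable (fun x => p x * Real.log (p x)
      + (Real.log (p x) + 1) * ((1 - r) * p x + r * n x - p x)) ρ := by
    refine (hpp.add (((hnp.add hni).sub (hpp.add hpi)).const_mul r)).congr
      (Eventually.of_forall fun x => ?_)
    simp only [Pi.add_apply, Pi.sub_apply]
    ring
  refine integrable_of_le_of_le (Measurable.aestronglyMeasurable (by fun_prop))
    (Eventually.of_forall fun x => ?_) (Eventually.of_forall fun x => ?_) hlow
    ((hpp.const_mul (1 - r)).add (hnn.const_mul r))
  · have := hp x
    have := hn x
    exact mul_log_tangent_le (hp x) (add_nonneg (mul_nonneg (by linarith) (hp x).le)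
      (mul_nonneg h0 (hn x)))
  · exact mix_mul_log_le (hp x).le (hn x) h0 h1

/-- The entropy is differentiable along segments that start at a positive density. By convexity the
difference quotients lie between the derivative and the quotient at the end of the segment, so
dominated convergence applies. -/
theorem tendsto_entropy_slope (hpm : Measurable p) (hnm : Measurable n) (hp : ∀ x, 0 < p x)
    (hn : ∀ x, 0 ≤ n x) (hpi : Integrable p ρ) (hni : Integrable n ρ)
    (hmass : ∫ x, n x ∂ρ = ∫ x, p x ∂ρ)
    (hpp : Integrable (fun x => p x * Real.log (p x)) ρ)
    (hnn : Integrable (fun x => n x * Real.log (n x)) ρ)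
    (hnp : Integrable (fun x => n x * Real.log (p x)) ρ) :
    Tendsto (fun r : ℝ =>
      (∫ x, ((1 - r) * p x + r * n x) * Real.log ((1 - r) * p x + r * n x) ∂ρ
        - ∫ x, p x * Real.log (p x) ∂ρ) / r) (𝓝[>] 0)
      (𝓝 (∫ x, n x * Real.log (p x) ∂ρ - ∫ x, p x * Real.log (p x) ∂ρ)) := by
  have hder : Integrable (fun x => (Real.log (p x) + 1) * (n x - p x)) ρ := by
    refine ((hnp.add hni).sub (hpp.add hpi)).congr (Eventually.of_forall fun x => ?_)
    simp only [Pi.add_apply, Pi.sub_apply]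
    ring
  have hval : ∫ x, (Real.log (p x) + 1) * (n x - p x) ∂ρ
      = ∫ x, n x * Real.log (p x) ∂ρ - ∫ x, p x * Real.log (p x) ∂ρ := by
    have h1 : ∀ x, (Real.log (p x) + 1) * (n x - p x)
        = (n x * Real.log (p x) + n x) - (p x * Real.log (p x) + p x) := fun x => by ring
    simp only [h1]
    have h2 : Integrable (fun x => n x * Real.log (p x) + n x) ρ := hnp.add hni
    have h3 : Integrable (fun x => p x * Real.log (p x) + p x) ρ := hpp.add hpi
    rw [integral_sub h2 h3, integral_add hnp hni, integral_add hpp hpi, hmass]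
    ring
  have hIoc : ∀ᶠ r : ℝ in 𝓝[>] 0, r ∈ Set.Ioc (0 : ℝ) 1 := Ioc_mem_nhdsGT one_pos
  have key := tendsto_integral_filter_of_dominated_convergence (μ := ρ) (l := 𝓝[>] (0 : ℝ))
    (F := fun (r : ℝ) x => (((1 - r) * p x + r * n x) * Real.log ((1 - r) * p x + r * n x)
      - p x * Real.log (p x)) / r)
    (f := fun x => (Real.log (p x) + 1) * (n x - p x))
    (fun x => |(Real.log (p x) + 1) * (n x - p x)|
      + |n x * Real.log (n x) - p x * Real.log (p x)|)
    (Eventually.of_forall fun r => Measurable.aestronglyMeasurable (by fun_prop))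
    ?_ (hder.abs.add (hnn.sub hpp).abs)
    (Eventually.of_forall fun x => tendsto_mix_mul_log (hp x) (n x))
  · rw [hval] at key
    refine key.congr' ?_
    filter_upwards [hIoc] with r hr
    rw [integral_div, integral_sub
      (integrable_mix_mul_log hpm hnm hp hn hpi hni hpp hnn hnp hr.1.le hr.2) hpp]
  · filter_upwards [hIoc] with r hr
    refine Eventually.of_forall fun x => ?_
    have hmix : 0 ≤ (1 - r) * p x + r * n x :=
      add_nonneg (mul_nonneg (by linarith [hr.2]) (hp x).le) (mul_nonneg hr.1.le (hn x))
    have h1 := mul_log_tangent_le (hp x) hmix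
    have h2 := mix_mul_log_le (hp x).le (hn x) hr.1.le hr.2
    have h3 : (Real.log (p x) + 1) * (n x - p x)
        ≤ (((1 - r) * p x + r * n x) * Real.log ((1 - r) * p x + r * n x)
          - p x * Real.log (p x)) / r := by
      rw [le_div_iff₀ hr.1]; linarith
    have h4 : (((1 - r) * p x + r * n x) * Real.log ((1 - r) * p x + r * n x)
          - p x * Real.log (p x)) / r ≤ n x * Real.log (n x) - p x * Real.log (p x) := by
      rw [div_le_iff₀ hr.1]; linarith
    rw [Real.norm_eq_abs]
    refine abs_le.2 ⟨?_, ?_⟩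
    · linarith [neg_abs_le ((Real.log (p x) + 1) * (n x - p x)),
        abs_nonneg (n x * Real.log (n x) - p x * Real.log (p x))]
    · linarith [le_abs_self (n x * Real.log (n x) - p x * Real.log (p x)),
        abs_nonneg ((Real.log (p x) + 1) * (n x - p x))]

end EntropyDerivative

/-! ### Displaced measures -/

section Displaced

variable {d : ℕ} {α α₁ α₂ : Measure (Eucl d)} {s t : ℝ}

theorem displaced_add [IsFiniteMeasure α₂]
    (h : ENNReal.ofReal t • α₂ ≤ α + ENNReal.ofReal t • α₁) :
    displaced α α₁ α₂ t + ENNReal.ofReal t • α₂ = α + ENNReal.ofReal t • α₁ := by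
  have : IsFiniteMeasure (ENNReal.ofReal t • α₂) := α₂.smul_finite ENNReal.ofReal_ne_top
  exact Measure.sub_add_cancel_of_le h

theorem integrable_displaced {u : Eucl d → ℝ} (hu : Integrable u α) (hu₁ : Integrable u α₁) :
    Integrable u (displaced α α₁ α₂ t) :=
  (hu.add_measure (hu₁.smul_measure ENNReal.ofReal_ne_top)).mono_measure Measure.sub_le

theorem integral_displaced [IsFiniteMeasure α₂] (ht : 0 ≤ t)
    (h : ENNReal.ofReal t • α₂ ≤ α + ENNReal.ofReal t • α₁) {u : Eucl d → ℝ}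
    (hu : Integrable u α) (hu₁ : Integrable u α₁) (hu₂ : Integrable u α₂) :
    ∫ x, u x ∂(displaced α α₁ α₂ t)
      = ∫ x, u x ∂α + t * (∫ x, u x ∂α₁ - ∫ x, u x ∂α₂) := by
  have h1 : ∫ x, u x ∂(displaced α α₁ α₂ t + ENNReal.ofReal t • α₂)
      = ∫ x, u x ∂(α + ENNReal.ofReal t • α₁) := by rw [displaced_add h]
  rw [integral_add_measure (integrable_displaced hu hu₁)
    (hu₂.smul_measure ENNReal.ofReal_ne_top),
    integral_add_measure hu (hu₁.smul_measure ENNReal.ofReal_ne_top), integral_smul_measure,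
    integral_smul_measure, ENNReal.toReal_ofReal ht, smul_eq_mul, smul_eq_mul] at h1
  linarith

theorem isProbabilityMeasure_displaced [IsProbabilityMeasure α] [IsProbabilityMeasure α₁]
    [IsProbabilityMeasure α₂] (h : ENNReal.ofReal t • α₂ ≤ α + ENNReal.ofReal t • α₁) :
    IsProbabilityMeasure (displaced α α₁ α₂ t) := by
  have h1 := congrArg (fun μ => μ Set.univ) (displaced_add h)
  simp only [Measure.add_apply, Measure.smul_apply, measure_univ, smul_eq_mul, mul_one] at h1
  exact ⟨(ENNReal.add_left_inj ENNReal.ofReal_ne_top).1 h1⟩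

/-- The displaced measures form a segment. -/
theorem displaced_eq_mix [IsFiniteMeasure α] [IsFiniteMeasure α₁] [IsFiniteMeasure α₂]
    (ht : 0 ≤ t) (hts : t ≤ s) (hs : 0 < s)
    (h : ENNReal.ofReal t • α₂ ≤ α + ENNReal.ofReal t • α₁)
    (h' : ENNReal.ofReal s • α₂ ≤ α + ENNReal.ofReal s • α₁) :
    displaced α α₁ α₂ t
      = ENNReal.ofReal (1 - t / s) • α + ENNReal.ofReal (t / s) • displaced α α₁ α₂ s := by
  have hmul : ENNReal.ofReal (t / s) * ENNReal.ofReal s = ENNReal.ofReal t := by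
    rw [← ENNReal.ofReal_mul (by positivity), div_mul_cancel₀ _ hs.ne']
  have hone : ENNReal.ofReal (1 - t / s) + ENNReal.ofReal (t / s) = 1 := by
    rw [← ENNReal.ofReal_add (by rw [sub_nonneg, div_le_one hs]; exact hts) (by positivity)]
    simp
  have : IsFiniteMeasure (ENNReal.ofReal t • α₂) := α₂.smul_finite ENNReal.ofReal_ne_top
  rw [← Measure.add_right_inj (ENNReal.ofReal t • α₂), add_comm, displaced_add h]
  calc α + ENNReal.ofReal t • α₁
      = (ENNReal.ofReal (1 - t / s) + ENNReal.ofReal (t / s)) • α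
        + (ENNReal.ofReal (t / s) * ENNReal.ofReal s) • α₁ := by rw [hone, hmul, one_smul]
    _ = ENNReal.ofReal (1 - t / s) • α
        + ENNReal.ofReal (t / s) • (α + ENNReal.ofReal s • α₁) := by
      rw [add_smul, smul_add, mul_smul, add_assoc]
    _ = ENNReal.ofReal t • α₂ + (ENNReal.ofReal (1 - t / s) • α
        + ENNReal.ofReal (t / s) • displaced α α₁ α₂ s) := by
      rw [← displaced_add h', smul_add, smul_smul, hmul]
      abel

end Displaced

/-! ### The upper bound of the primal value along a segment -/

section Segment

variable {d : ℕ} {ε : ℝ} {α β α' β' : Measure (Eucl d)} {f g : Eucl d → ℝ}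

theorem IsTransportPlan.mix {π π' : Measure (Eucl d × Eucl d)} (h : IsTransportPlan α β π)
    (h' : IsTransportPlan α' β' π') (c c' : ℝ≥0∞) :
    IsTransportPlan (c • α + c' • α') (c • β + c' • β') (c • π + c' • π') := by
  constructor
  · rw [Measure.fst_add, ← h.1, ← h'.1]
    simp only [Measure.fst, Measure.map_smul]
  · rw [Measure.snd_add, ← h.2, ← h'.2]
    simp only [Measure.snd, Measure.map_smul]

/-- A measure of finite entropy has a nonnegative density with integrable `a log a`. -/
theorem exists_density_of_relEntropy_ne_top {X : Type*} [MeasurableSpace X] {μ ρ : Measure X}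
    [IsFiniteMeasure μ] [SigmaFinite ρ] (h : relEntropy μ ρ ≠ ⊤) :
    ∃ a : X → ℝ, Measurable a ∧ (∀ x, 0 ≤ a x) ∧
      μ = ρ.withDensity (fun x => ENNReal.ofReal (a x)) ∧
      Integrable a ρ ∧ Integrable (fun x => a x * Real.log (a x)) ρ := by
  have hE : μ ≪ ρ ∧ Integrable (llr μ ρ) μ := by
    by_contra hn
    exact h (if_neg hn)
  refine ⟨fun x => (μ.rnDeriv ρ x).toReal, (μ.measurable_rnDeriv ρ).ennreal_toReal,
    fun _ => ENNReal.toReal_nonneg, ?_, Measure.integrable_toReal_rnDeriv, ?_⟩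
  · conv_lhs => rw [← Measure.withDensity_rnDeriv_eq μ ρ hE.1]
    refine withDensity_congr_ae ?_
    filter_upwards [Measure.rnDeriv_lt_top μ ρ] with x hx
    rw [ENNReal.ofReal_toReal hx.ne]
  · exact (integrable_rnDeriv_smul_iff hE.1).2 hE.2

theorem integrable_prod_mul_log {X Y : Type*} [MeasurableSpace X] [MeasurableSpace Y]
    {ρ₁ : Measure X} {ρ₂ : Measure Y} {a : X → ℝ} {b : Y → ℝ}
    (ha : Integrable a ρ₁) (hb : Integrable b ρ₂)
    (hla : Integrable (fun x => a x * Real.log (a x)) ρ₁)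
    (hlb : Integrable (fun y => b y * Real.log (b y)) ρ₂) :
    Integrable (fun z : X × Y => a z.1 * b z.2 * Real.log (a z.1 * b z.2)) (ρ₁.prod ρ₂) := by
  refine ((hla.mul_prod hb).add (ha.mul_prod hlb)).congr (Eventually.of_forall fun z => ?_)
  simp only [Pi.add_apply]
  by_cases h1 : a z.1 = 0
  · simp [h1]
  by_cases h2 : b z.2 = 0
  · simp [h2]
  rw [Real.log_mul h1 h2]
  ring

/-- Let `(f, g)` be potentials of a Gibbs plan between `α` and `β`. Mixing this plan with the
product of `α'` and `β'` gives competitors whose objective has at `r = 0` the derivative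
`∫ f d(α' - α) + ∫ g d(β' - β)`: the derivative of the primal objective at the Gibbs plan is the
integral of `f(x) + g(y)` against the change of the plan, which depends on its marginals only. -/
theorem exists_primal_bound_on_segment [IsProbabilityMeasure α] [IsProbabilityMeasure β]
    [IsProbabilityMeasure α'] [IsProbabilityMeasure β'] (hε : 0 < ε)
    (hf : Measurable f) (hg : Measurable g)
    (hfα : Integrable f α) (hgβ : Integrable g β) (hfα' : Integrable f α')
    (hgβ' : Integrable g β')
    (hα2 : Integrable (fun x => ‖x‖ ^ 2) α) (hβ2 : Integrable (fun x => ‖x‖ ^ 2) β)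
    (hα2' : Integrable (fun x => ‖x‖ ^ 2) α') (hβ2' : Integrable (fun x => ‖x‖ ^ 2) β')
    (hE : relEntropy α' volume ≠ ⊤) (hE' : relEntropy β' volume ≠ ⊤)
    (hπ : IsTransportPlan α β (gibbsPlan ε volume volume f g)) :
    ∃ P : ℝ → ℝ, (∀ r, 0 ≤ r → r ≤ 1 →
        otLebesgue ε (ENNReal.ofReal (1 - r) • α + ENNReal.ofReal r • α')
          (ENNReal.ofReal (1 - r) • β + ENNReal.ofReal r • β') ≤ (P r : EReal)) ∧
      Tendsto (fun r => (P r - (∫ x, f x ∂α + ∫ y, g y ∂β)) / r) (𝓝[>] 0)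
        (𝓝 ((∫ x, f x ∂α' - ∫ x, f x ∂α) + (∫ y, g y ∂β' - ∫ y, g y ∂β))) := by
  obtain ⟨a', ha'm, ha'0, hα', ha'i, ha'l⟩ := exists_density_of_relEntropy_ne_top hE
  obtain ⟨b', hb'm, hb'0, hβ', hb'i, hb'l⟩ := exists_density_of_relEntropy_ne_top hE'
  have hπp := hπ.isProbabilityMeasure
  set ρ : Measure (Eucl d × Eucl d) := volume.prod volume with hρ
  set p := gibbsDensity ε f g with hp_def
  set n : Eucl d × Eucl d → ℝ := fun z => a' z.1 * b' z.2 with hn_def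
  have hpm : Measurable p := measurable_gibbsDensity hf hg
  have hnm : Measurable n := by fun_prop
  have hn0 : ∀ z, 0 ≤ n z := fun z => mul_nonneg (ha'0 _) (hb'0 _)
  have hν : IsTransportPlan α' β' (α'.prod β') := isTransportPlan_prod
  have hν_eq : α'.prod β' = ρ.withDensity fun z => ENNReal.ofReal (n z) := by
    conv_lhs => rw [hα', hβ']
    rw [prod_withDensity ha'm.ennreal_ofReal hb'm.ennreal_ofReal]
    simp only [hn_def, ENNReal.ofReal_mul (ha'0 _), hρ]
  have hint_n : ∀ h : Eucl d × Eucl d → ℝ, Integrable h (α'.prod β') ↔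
      Integrable (fun z => n z * h z) ρ := fun h => by
    rw [hν_eq, integrable_withDensity_iff_integrable_smul' hnm.ennreal_ofReal
      (Eventually.of_forall fun _ => ENNReal.ofReal_lt_top)]
    simp only [ENNReal.toReal_ofReal (hn0 _), smul_eq_mul]
  have hval_n : ∀ h : Eucl d × Eucl d → ℝ, ∫ z, h z ∂(α'.prod β') = ∫ z, n z * h z ∂ρ :=
    fun h => by
    rw [hν_eq, integral_withDensity_eq_integral_toReal_smul hnm.ennreal_ofReal
      (Eventually.of_forall fun _ => ENNReal.ofReal_lt_top)]
    simp only [ENNReal.toReal_ofReal (hn0 _), smul_eq_mul]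
  have hC := hπ.integrable_cost hα2 hβ2
  have hC' := hν.integrable_cost hα2' hβ2'
  have huv : Integrable (fun z => f z.1 + g z.2) (gibbsPlan ε volume volume f g) :=
    (hπ.integrable_fst hfα).add (hπ.integrable_snd hgβ)
  have huv' : Integrable (fun z => f z.1 + g z.2) (α'.prod β') :=
    (hν.integrable_fst hfα').add (hν.integrable_snd hgβ')
  have hlog : Integrable (fun z => Real.log (p z)) (gibbsPlan ε volume volume f g) := by
    simp only [hp_def, log_gibbsDensity]
    exact (huv.sub hC).div_const ε
  have hlog' : Integrable (fun z => Real.log (p z)) (α'.prod β') := by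
    simp only [hp_def, log_gibbsDensity]
    exact (huv'.sub hC').div_const ε
  have hpi : Integrable p ρ := by
    have := (integrable_gibbsPlan_iff (ε := ε) (m₁ := volume) (m₂ := volume) hf hg).1
      (integrable_const (1 : ℝ))
    simpa only [mul_one] using this
  have hni : Integrable n ρ := by
    have := (hint_n _).1 (integrable_const (1 : ℝ))
    simpa only [mul_one] using this
  have hmass : ∫ z, n z ∂ρ = ∫ z, p z ∂ρ := by
    have h1 := hval_n fun _ => 1
    have h2 := integral_gibbsPlan (ε := ε) (m₁ := volume) (m₂ := volume) hf hg fun _ => 1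
    simp only [mul_one, integral_const, probReal_univ, smul_eq_mul] at h1 h2
    rw [← h1, h2]
  have hpp : Integrable (fun z => p z * Real.log (p z)) ρ :=
    (integrable_gibbsPlan_iff hf hg).1 hlog
  have hnp : Integrable (fun z => n z * Real.log (p z)) ρ := (hint_n _).1 hlog'
  have hnn : Integrable (fun z => n z * Real.log (n z)) ρ :=
    integrable_prod_mul_log ha'i hb'i ha'l hb'l
  have hp0 : ∀ z, 0 < p z := gibbsDensity_pos
  set c := ∫ z, ‖z.1 - z.2‖ ^ 2 ∂(gibbsPlan ε volume volume f g) with hc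
  set c' := ∫ z, ‖z.1 - z.2‖ ^ 2 ∂(α'.prod β') with hc'
  refine ⟨fun r => (1 - r) * c + r * c' + ε * ∫ z, ((1 - r) * p z + r * n z)
    * Real.log ((1 - r) * p z + r * n z) ∂ρ, fun r h0 h1 => ?_, ?_⟩
  · have h1' : 0 ≤ 1 - r := by linarith
    have hmix := hπ.mix hν (ENNReal.ofReal (1 - r)) (ENNReal.ofReal r)
    refine (entropicOT_le_primalObjective hmix).trans (le_of_eq ?_)
    have hCmix := (hC.smul_measure (c := ENNReal.ofReal (1 - r)) ENNReal.ofReal_ne_top).add_measure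
      (hC'.smul_measure (c := ENNReal.ofReal r) ENNReal.ofReal_ne_top)
    have hdens : ENNReal.ofReal (1 - r) • gibbsPlan ε volume volume f g
        + ENNReal.ofReal r • α'.prod β'
        = ρ.withDensity fun z => ENNReal.ofReal ((1 - r) * p z + r * n z) := by
      rw [hν_eq, gibbsPlan, ← withDensity_smul _ hpm.ennreal_ofReal,
        ← withDensity_smul _ hnm.ennreal_ofReal,
        ← withDensity_add_left (hpm.ennreal_ofReal.const_smul _)]
      congr 1
      funext z
      simp only [Pi.add_apply, Pi.smul_apply, smul_eq_mul]
      rw [ENNReal.ofReal_add (mul_nonneg h1' (hp0 z).le) (mul_nonneg h0 (hn0 z)),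
        ENNReal.ofReal_mul h1', ENNReal.ofReal_mul h0]
    have hent : relEntropy (ENNReal.ofReal (1 - r) • gibbsPlan ε volume volume f g
        + ENNReal.ofReal r • α'.prod β') (volume.prod volume)
        = ((∫ z, ((1 - r) * p z + r * n z) * Real.log ((1 - r) * p z + r * n z) ∂ρ : ℝ)
          : EReal) := by
      rw [hdens]
      exact relEntropy_withDensity ρ (by fun_prop)
        (fun z => add_nonneg (mul_nonneg h1' (hp0 z).le) (mul_nonneg h0 (hn0 z)))
        (integrable_mix_mul_log hpm hnm hp0 hn0 hpi hni hpp hnn hnp h0 h1)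
    rw [primalObjective_eq_coe hCmix hent,
      integral_add_measure (hC.smul_measure ENNReal.ofReal_ne_top)
        (hC'.smul_measure ENNReal.ofReal_ne_top), integral_smul_measure, integral_smul_measure,
      ENNReal.toReal_ofReal h1', ENNReal.toReal_ofReal h0]
    rfl
  · have hslope := tendsto_entropy_slope hpm hnm hp0 hn0 hpi hni hmass hpp hnn hnp
    have hA : ∫ z, p z * Real.log (p z) ∂ρ = (∫ x, f x ∂α + ∫ y, g y ∂β - c) / ε := by
      rw [← integral_gibbsPlan hf hg]
      simp only [hp_def, log_gibbsDensity]
      rw [integral_div, integral_sub huv hC,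
        integral_add (hπ.integrable_fst hfα) (hπ.integrable_snd hgβ), hπ.integral_fst hfα,
        hπ.integral_snd hgβ]
    have hB : ∫ z, n z * Real.log (p z) ∂ρ = (∫ x, f x ∂α' + ∫ y, g y ∂β' - c') / ε := by
      rw [← hval_n]
      simp only [hp_def, log_gibbsDensity]
      rw [integral_div, integral_sub huv' hC',
        integral_add (hν.integrable_fst hfα') (hν.integrable_snd hgβ'), hν.integral_fst hfα',
        hν.integral_snd hgβ']
    have hlim := (hslope.const_mul ε).const_add (c' - c)
    have hval : c' - c + ε * (∫ z, n z * Real.log (p z) ∂ρ - ∫ z, p z * Real.log (p z) ∂ρ)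
        = (∫ x, f x ∂α' - ∫ x, f x ∂α) + (∫ y, g y ∂β' - ∫ y, g y ∂β) := by
      rw [hA, hB]
      field_simp; ring
    rw [hval] at hlim
    refine hlim.congr' ?_
    filter_upwards [self_mem_nhdsWithin] with r hr
    have hr0 : r ≠ 0 := ne_of_gt hr
    have hA' : ∫ x, f x ∂α + ∫ y, g y ∂β = c + ε * ∫ z, p z * Real.log (p z) ∂ρ := by
      rw [hA]; field_simp; ring
    rw [hA']
    field_simp; ring

end Segment

/-! ### Differentiability and conclusion -/

section Gradient

variable {d : ℕ} {ε : ℝ} {α β : Measure (Eucl d)} {f g : Eucl d → ℝ}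

/-- The value along feasible directions is squeezed between its affine lower bound from weak duality
with the fixed potentials `(f, g)` and the primal value of mixtures of plans. -/
theorem hasFeasibleGradient_of_gibbsPlan [IsProbabilityMeasure α] [IsProbabilityMeasure β]
    (hε : 0 < ε) (hf : Measurable f) (hg : Measurable g)
    (hfα : Integrable f α) (hgβ : Integrable g β)
    (hα : HasGaussianTail α) (hβ : HasGaussianTail β)
    (hf' : ∀ α₁ α₂, IsFeasibleDirection α α₁ α₂ → Integrable f α₁ ∧ Integrable f α₂)
    (hg' : ∀ β₁ β₂, IsFeasibleDirection β β₁ β₂ → Integrable g β₁ ∧ Integrable g β₂)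
    (hπ : IsTransportPlan α β (gibbsPlan ε volume volume f g)) :
    HasFeasibleGradient (otLebesgue ε) α β f g := by
  have hF := (isDualOptimal_of_gibbsPlan hε hf hg hfα hgβ hα.integrable_sq hβ.integrable_sq hπ).2
  have hF' : otLebesgue ε α β = ((∫ x, f x ∂α + ∫ y, g y ∂β : ℝ) : EReal) := hF
  refine ⟨by rw [hF']; exact EReal.coe_ne_top _, by rw [hF']; exact EReal.coe_ne_bot _,
    fun α₁ α₂ β₁ β₂ hA hB => ?_⟩
  have := hA.prob₁
  have := hA.prob₂
  have := hB.prob₁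
  have := hB.prob₂
  obtain ⟨hf₁, hf₂⟩ := hf' _ _ hA
  obtain ⟨hg₁, hg₂⟩ := hg' _ _ hB
  refine ⟨hf₁, hf₂, hg₁, hg₂, ?_⟩
  set G := (∫ x, f x ∂α₁ - ∫ x, f x ∂α₂) + (∫ y, g y ∂β₁ - ∫ y, g y ∂β₂) with hG
  set F₀ := ∫ x, f x ∂α + ∫ y, g y ∂β with hF₀
  -- a step `s` up to which the displaced measures are defined, with finite entropy at `s`
  obtain ⟨s₀, hs₀, hsub⟩ := mem_nhdsGT_iff_exists_Ioo_subset.1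
    ((hA.nonneg.and hB.nonneg).and (hA.entropy.and hB.entropy))
  have hs₀' : 0 < s₀ := hs₀
  obtain ⟨s, hs, hss₀⟩ : ∃ s, 0 < s ∧ s < s₀ := ⟨s₀ / 2, by linarith, by linarith⟩
  obtain ⟨⟨hAs, hBs⟩, hEA, hEB⟩ := hsub ⟨hs, hss₀⟩
  have := isProbabilityMeasure_displaced hAs
  have := isProbabilityMeasure_displaced hBs
  obtain ⟨τ₁, hτ₁, hA1⟩ := hA.subGaussian₁
  obtain ⟨τ₂, hτ₂, hB1⟩ := hB.subGaussian₁
  obtain ⟨P, hP, hPlim⟩ := exists_primal_bound_on_segment hε hf hg hfα hgβ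
    (integrable_displaced (α₂ := α₂) (t := s) hfα hf₁)
    (integrable_displaced (α₂ := β₂) (t := s) hgβ hg₁)
    hα.integrable_sq hβ.integrable_sq
    (integrable_displaced hα.integrable_sq (hA1.hasGaussianTail hτ₁).integrable_sq)
    (integrable_displaced hβ.integrable_sq (hB1.hasGaussianTail hτ₂).integrable_sq)
    hEA hEB hπ
  have hlimval : (∫ x, f x ∂(displaced α α₁ α₂ s) - ∫ x, f x ∂α)
      + (∫ y, g y ∂(displaced β β₁ β₂ s) - ∫ y, g y ∂β) = s * G := by
    rw [integral_displaced hs.le hAs hfα hf₁ hf₂, integral_displaced hs.le hBs hgβ hg₁ hg₂]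
    ring
  rw [hlimval] at hPlim
  have hIoo : ∀ᶠ t : ℝ in 𝓝[>] 0, t ∈ Set.Ioo (0 : ℝ) s := Ioo_mem_nhdsGT hs
  have hbounds : ∀ t ∈ Set.Ioo (0 : ℝ) s,
      ((F₀ + t * G : ℝ) : EReal) ≤ otLebesgue ε (displaced α α₁ α₂ t) (displaced β β₁ β₂ t) ∧
      otLebesgue ε (displaced α α₁ α₂ t) (displaced β β₁ β₂ t) ≤ (P (t / s) : EReal) := by
    intro t ht
    obtain ⟨⟨hAt, hBt⟩, -⟩ := hsub ⟨ht.1, ht.2.trans hss₀⟩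
    have := isProbabilityMeasure_displaced hAt
    constructor
    · have h1 := dualObjective_le_entropicOT (m₁ := volume) (m₂ := volume) hε
        (integrable_displaced (α₂ := α₂) (t := t) hfα hf₁)
        (integrable_displaced (α₂ := β₂) (t := t) hgβ hg₁)
      rw [dualObjective_eq_of_gibbsPlan hπ, integral_displaced ht.1.le hAt hfα hf₁ hf₂,
        integral_displaced ht.1.le hBt hgβ hg₁ hg₂] at h1
      refine le_trans (le_of_eq ?_) h1
      congr 1
      rw [hF₀, hG]; ring
    · rw [displaced_eq_mix ht.1.le ht.2.le hs hAt hAs, displaced_eq_mix ht.1.le ht.2.le hs hBt hBs]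
      exact hP _ (div_nonneg ht.1.le hs.le) ((div_le_one hs).2 ht.2.le)
  have hfin : ∀ t ∈ Set.Ioo (0 : ℝ) s,
      otLebesgue ε (displaced α α₁ α₂ t) (displaced β β₁ β₂ t) ≠ ⊤ ∧
      otLebesgue ε (displaced α α₁ α₂ t) (displaced β β₁ β₂ t) ≠ ⊥ := fun t ht => by
    obtain ⟨h1, h2⟩ := hbounds t ht
    exact ⟨ne_top_of_le_ne_top (EReal.coe_ne_top _) h2, ne_bot_of_le_ne_bot (EReal.coe_ne_bot _) h1⟩
  refine ⟨hIoo.mono hfin, ?_⟩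
  rw [isLittleO_iff_tendsto' (by
    filter_upwards [self_mem_nhdsWithin] with t ht h0
    exact absurd h0 (ne_of_gt ht))]
  have hscale : Tendsto (fun t : ℝ => t / s) (𝓝[>] 0) (𝓝[>] 0) := by
    refine tendsto_nhdsWithin_iff.2 ⟨?_, ?_⟩
    · have : Tendsto (fun t : ℝ => t / s) (𝓝 0) (𝓝 (0 / s)) := tendsto_id.div_const s
      rw [zero_div] at this
      exact this.mono_left nhdsWithin_le_nhds
    · filter_upwards [self_mem_nhdsWithin] with t ht
      exact div_pos ht hs
  have hup : Tendsto (fun t : ℝ => (P (t / s) - F₀) / (t / s) / s - G) (𝓝[>] 0) (𝓝 0) := by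
    have := ((hPlim.comp hscale).div_const s).sub_const G
    rwa [mul_div_cancel_left₀ _ hs.ne', sub_self] at this
  refine tendsto_of_tendsto_of_tendsto_of_le_of_le' tendsto_const_nhds hup ?_ ?_
  · filter_upwards [hIoo] with t ht
    obtain ⟨h1, -⟩ := hbounds t ht
    obtain ⟨h3, h4⟩ := hfin t ht
    have h5 := EReal.toReal_le_toReal h1 (EReal.coe_ne_bot _) h3
    rw [EReal.toReal_coe] at h5
    rw [hF', EReal.toReal_coe]
    exact div_nonneg (by linarith) ht.1.le
  · filter_upwards [hIoo] with t ht
    obtain ⟨-, h2⟩ := hbounds t ht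
    obtain ⟨h3, h4⟩ := hfin t ht
    have h5 := EReal.toReal_le_toReal h2 h4 (EReal.coe_ne_top _)
    rw [EReal.toReal_coe] at h5
    rw [hF', EReal.toReal_coe]
    have ht0 : t ≠ 0 := ht.1.ne'
    have h6 : (P (t / s) - F₀) / (t / s) / s - G = (P (t / s) - F₀ - t * G) / t := by
      field_simp
    rw [h6]
    exact div_le_div_of_nonneg_right (by linarith) ht.1.le

end Gradient

theorem mainTheorem8 (d : ℕ) (ε σ : ℝ) (hε : 0 < ε) (hσ : 0 < σ)
    (a b : Eucl d → ℝ) (ha : Measurable a) (hb : Measurable b)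
    (ha_pos : ∀ x, 0 < a x) (hb_pos : ∀ x, 0 < b x)
    (α β : Measure (Eucl d)) [IsProbabilityMeasure α] [IsProbabilityMeasure β]
    (hα : α = volume.withDensity (fun x => ENNReal.ofReal (a x)))
    (hβ : β = volume.withDensity (fun x => ENNReal.ofReal (b x)))
    (hαG : SubGaussian σ α) (hβG : SubGaussian σ β)
    (hαE : relEntropy α volume ≠ ⊤) (hβE : relEntropy β volume ≠ ⊤) :
    (∃ φ ψ : Eucl d → ℝ, IsProductSinkhorn ε α β φ ψ) ∧
    (∀ φ ψ : Eucl d → ℝ, IsProductSinkhorn ε α β φ ψ →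
      Continuous φ ∧ Continuous ψ ∧ IsDualOptimal ε α β α β φ ψ ∧
      otProduct ε α β = ((∫ x, φ x ∂α + ∫ y, ψ y ∂β : ℝ) : EReal)) ∧
    (∀ φ ψ : Eucl d → ℝ, IsProductSinkhorn ε α β φ ψ ↔
      IsLebesgueSinkhorn ε α β a b
        (fun x => φ x + ε * Real.log (a x)) (fun y => ψ y + ε * Real.log (b y))) ∧
    (∀ f g : Eucl d → ℝ, IsLebesgueSinkhorn ε α β a b f g →
      (Continuous a → Continuous f) ∧ (Continuous b → Continuous g) ∧
      IsDualOptimal ε volume volume α β f g ∧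
      otLebesgue ε α β = dualObjective ε volume volume α β f g ∧
      otLebesgue ε α β = ((∫ x, f x ∂α + ∫ y, g y ∂β : ℝ) : EReal) ∧
      HasFeasibleGradient (otLebesgue ε) α β f g) := by
  have hαT := hαG.hasGaussianTail hσ
  have hβT := hβG.hasGaussianTail hσ
  have hiff : ∀ φ ψ : Eucl d → ℝ, IsProductSinkhorn ε α β φ ψ ↔
      IsLebesgueSinkhorn ε α β a b
        (fun x => φ x + ε * Real.log (a x)) (fun y => ψ y + ε * Real.log (b y)) := fun φ ψ =>
    isProductSinkhorn_iff_isLebesgueSinkhorn hε ha hb ha_pos hb_pos hα hβ hαE hβE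
  refine ⟨?_, fun φ ψ h => ?_, hiff, fun f g h => ?_⟩
  · obtain ⟨K, φ, ψ, hφ, hψ, h₁, h₂⟩ := exists_softTransform_fixedPoint hαT hβT hε
    exact ⟨φ, ψ, isProductSinkhorn_of_softTransform hε (hφ.integrable hαT) (hψ.integrable hβT)
      (hφ.integrable_kernel hαT hε) (hψ.integrable_kernel hβT hε) h₁ h₂⟩
  · have hφ := h.swap.continuous_snd hε
    have hψ := h.continuous_snd hε
    exact ⟨hφ, hψ, isDualOptimal_of_gibbsPlan hε hφ.measurable hψ.measurable h.integrable_fst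
      h.integrable_snd hαT.integrable_sq hβT.integrable_sq (h.isTransportPlan hε)⟩
  · obtain ⟨φ, hf_eq⟩ : ∃ φ : Eucl d → ℝ, f = fun x => φ x + ε * Real.log (a x) :=
      ⟨fun x => f x - ε * Real.log (a x), by funext x; ring⟩
    obtain ⟨ψ, hg_eq⟩ : ∃ ψ : Eucl d → ℝ, g = fun y => ψ y + ε * Real.log (b y) :=
      ⟨fun y => g y - ε * Real.log (b y), by funext y; ring⟩
    have hprod : IsProductSinkhorn ε α β φ ψ := by
      rw [hiff, ← hf_eq, ← hg_eq]; exact h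
    have hφ := hprod.swap.continuous_snd hε
    have hψ := hprod.continuous_snd hε
    have hf : Measurable f := by
      rw [hf_eq]; exact hφ.measurable.add (ha.log.const_mul ε)
    have hg : Measurable g := by
      rw [hg_eq]; exact hψ.measurable.add (hb.log.const_mul ε)
    have hπ := h.isTransportPlan hf hg ha_pos hb_pos hα hβ
    obtain ⟨hopt, hval⟩ := isDualOptimal_of_gibbsPlan hε hf hg h.integrable_fst h.integrable_snd
      hαT.integrable_sq hβT.integrable_sq hπ
    have hval' : otLebesgue ε α β = ((∫ x, f x ∂α + ∫ y, g y ∂β : ℝ) : EReal) := hval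
    obtain ⟨K, hφK⟩ := hprod.exists_isTame hαT hβT hε
    obtain ⟨L, hψL⟩ := hprod.swap.exists_isTame hβT hαT hε
    -- the potentials are the sum of a tame function and a logarithm that is integrable by feasibility
    have hpair : ∀ {c χ : Eucl d → ℝ} {M : ℝ} {μ μ₁ : Measure (Eucl d)} {τ : ℝ},
        Measurable c → (∀ x, 0 < c x) →
        μ = volume.withDensity (fun x => ENNReal.ofReal (c x)) → IsTame M χ →
        IsProbabilityMeasure μ₁ → 0 < τ → SubGaussian τ μ₁ → μ₁ ≪ volume →
        Integrable (llr μ volume) μ₁ → Integrable (fun x => χ x + ε * Real.log (c x)) μ₁ := by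
      intro c χ M μ μ₁ τ hc hc0 hμ hχ hμ₁ hτ hsub hac hllr
      exact (hχ.integrable (hsub.hasGaussianTail hτ)).add
        ((hllr.congr (hac.ae_le (llr_withDensity_ae_eq hc hc0 hμ))).const_mul ε)
    refine ⟨fun hac => ?_, fun hbc => ?_, hopt, ?_, hval', ?_⟩
    · rw [hf_eq]
      exact hφ.add ((hac.log fun x => (ha_pos x).ne').const_mul ε)
    · rw [hg_eq]
      exact hψ.add ((hbc.log fun x => (hb_pos x).ne').const_mul ε)
    · rw [hval', dualObjective_eq_of_gibbsPlan hπ]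
    · refine hasFeasibleGradient_of_gibbsPlan hε hf hg h.integrable_fst h.integrable_snd hαT hβT
        (fun α₁ α₂ hA => ?_) (fun β₁ β₂ hB => ?_) hπ
      · obtain ⟨τ₁, hτ₁, h₁⟩ := hA.subGaussian₁
        obtain ⟨τ₂, hτ₂, h₂⟩ := hA.subGaussian₂
        rw [hf_eq]
        exact ⟨hpair ha ha_pos hα hφK hA.prob₁ hτ₁ h₁ hA.ac₁ hA.log₁,
          hpair ha ha_pos hα hφK hA.prob₂ hτ₂ h₂ hA.ac₂ hA.log₂⟩
      · obtain ⟨τ₁, hτ₁, h₁⟩ := hB.subGaussian₁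
        obtain ⟨τ₂, hτ₂, h₂⟩ := hB.subGaussian₂
        rw [hg_eq]
        exact ⟨hpair hb hb_pos hβ hψL hB.prob₁ hτ₁ h₁ hB.ac₁ hB.log₁,
          hpair hb hb_pos hβ hψL hB.prob₂ hτ₂ h₂ hB.ac₂ hB.log₂⟩
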